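/- Let $A,B$ be nonzero complex constants. Consider, for holomorphic functions $\vartheta_2,\vartheta_3,\vartheta_4,\eta$ of a complex variable $\tau$, the non-canonical $\vartheta,\eta$-system $$\frac{d\vartheta_2}{d\tau}=\frac{i}{\pi}\Big\{\eta+\frac{\pi^2}{12}(\vartheta_3^4+\vartheta_4^4)\Big\}\vartheta_2,\qquad \frac{d\vartheta_3}{d\tau}=\frac{i}{\pi}\Big\{\eta+\frac{\pi^2}{12}(\vartheta_3^4+\vartheta_4^4-3B^4\vartheta_4^4)\Big\}\vartheta_3,$$ $$\frac{d\vartheta_4}{d\tau}=\frac{i}{\pi}\Big\{\eta+\frac{\pi^2}{12}(\vartheta_3^4+\vartheta_4^4-3A^4\vartheta_3^4)\Big\}\vartheta_4,$$ $$\frac{d\eta}{d\tau}=\frac{i}{\pi}\,2\eta^2-\frac{\pi^3}{72}\,i\,\Big\{\vartheta_3^8+(9A^4B^4-6A^4-6B^4+2)\,\vartheta_3^4\vartheta_4^4+\vartheta_4^8\Big\}.$$ For $\operatorname{Im} T>0$ let $\vartheta_2(T)=\sum_{k\in\mathbb Z}e^{(k+1/2)^2\pi iT}$, $\vartheta_3(T)=\sum_{k\in\mathbb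 Z}e^{k^2\pi iT}$, $\vartheta_4(T)=\sum_{k\in\mathbb Z}(-1)^ke^{k^2\pi iT}$ and $\eta(T)=2\pi^2\big\{\frac1{24}-\sum_{k\ge1}\frac{e^{2k\pi iT}}{(1-e^{2k\pi iT})^2}\big\}$ be the canonical series. For complex constants $a,b,c,d,\delta$ with $a\delta-bc=1$ put $T=\frac{a\tau+b}{c\tau+\delta}$ and $$\vartheta_2=d\,\frac{\vartheta_2(T)}{\sqrt{c\tau+\delta}},\qquad \vartheta_3=\frac1A\,\frac{\vartheta_3(T)}{\sqrt{c\tau+\delta}},\qquad \vartheta_4=\frac1B\,\frac{\vartheta_4(T)}{\sqrt{c\tau+\delta}},\qquad(\ast)$$ $$\eta=\frac{1}{(c\tau+\delta)^2}\Big\{\eta(T)+\frac{\pi^2}{12}\big[(1-A^{-4})\,\vartheta_3^4(T)+(1-B^{-4})\,\vartheta_4^4(T)\big]\Big\}+\frac12\,\frac{\pi i c}{c\tau+\delta},$$ where the same continuous branch of $\sqrt{c\tau+\delta}$ is used in all three formulas of the first line. Then $(\ast)$ is the general solution of the system, in the following sense. 1. If $D\subseteq\mathbb C$ is open, $c\tau+\delta\ne0$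 and $\operatorname{Im}T>0$ for all $\tau\in D$, and a continuous branch of $\sqrt{c\tau+\delta}$ on $D$ is chosen, then $(\ast)$ is a solution of the system on $D$. 2. Conversely, let $D\subseteq\mathbb C$ be open and connected and let $(\vartheta_2,\vartheta_3,\vartheta_4,\eta)$ be a solution on $D$ that is non-degenerate, i.e. at some point of $D$ one has $\vartheta_3\ne0$, $\vartheta_4\ne0$ and $A^4\vartheta_3^4\ne B^4\vartheta_4^4$. Then there are complex constants $a,b,c,d,\delta$ with $a\delta-bc=1$, such that $c\tau+\delta\neq0$ and $\operatorname{Im}T>0$ on all of $D$, and a continuous branch of $\sqrt{c\tau+\delta}$ on $D$, such that the solution is given by $(\ast)$ on $D$. -/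

import Mathlib

open Complex

namespace ThetaSystem

/-- The canonical series `ϑ₂(τ) = ∑ e^{(k+1/2)² π i τ}` over `k ∈ ℤ`. -/
noncomputable def theta2 (τ : ℂ) : ℂ :=
  ∑' k : ℤ, cexp (((k : ℂ) + 1 / 2) ^ 2 * (Real.pi : ℂ) * I * τ)

/-- The canonical series `ϑ₃(τ) = ∑ e^{k² π i τ}` over `k ∈ ℤ`. -/
noncomputable def theta3 (τ : ℂ) : ℂ :=
  ∑' k : ℤ, cexp ((k : ℂ) ^ 2 * (Real.pi : ℂ) * I * τ)

/-- The canonical series `ϑ₄(τ) = ∑ (-1)^k e^{k² π i τ}` over `k ∈ ℤ`. -/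
noncomputable def theta4 (τ : ℂ) : ℂ :=
  ∑' k : ℤ, (-1 : ℂ) ^ k * cexp ((k : ℂ) ^ 2 * (Real.pi : ℂ) * I * τ)

/-- The canonical series of the Weierstrass eta function,
`η(τ) = 2π² (1/24 - ∑_{k ≥ 1} e^{2kπiτ} / (1 - e^{2kπiτ})²)`; the summation index below is `k - 1`. -/
noncomputable def weierstrassEta (τ : ℂ) : ℂ :=
  2 * (Real.pi : ℂ) ^ 2 * (1 / 24 - ∑' k : ℕ,
    cexp (2 * ((k : ℂ) + 1) * (Real.pi : ℂ) * I * τ) /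
      (1 - cexp (2 * ((k : ℂ) + 1) * (Real.pi : ℂ) * I * τ)) ^ 2)

/-- `(v₂, v₃, v₄, h)` is a holomorphic solution on the set `D` of the non-canonical
`ϑ, η`-system with parameters `A`, `B`. -/
structure IsSolution (A B : ℂ) (D : Set ℂ) (v₂ v₃ v₄ h : ℂ → ℂ) : Prop where
  deriv_two : ∀ τ ∈ D, HasDerivAt v₂
    (I / (Real.pi : ℂ) * (h τ + (Real.pi : ℂ) ^ 2 / 12 * (v₃ τ ^ 4 + v₄ τ ^ 4)) * v₂ τ) τ
  deriv_three : ∀ τ ∈ D, HasDerivAt v₃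
    (I / (Real.pi : ℂ) * (h τ + (Real.pi : ℂ) ^ 2 / 12 *
      (v₃ τ ^ 4 + v₄ τ ^ 4 - 3 * B ^ 4 * v₄ τ ^ 4)) * v₃ τ) τ
  deriv_four : ∀ τ ∈ D, HasDerivAt v₄
    (I / (Real.pi : ℂ) * (h τ + (Real.pi : ℂ) ^ 2 / 12 *
      (v₃ τ ^ 4 + v₄ τ ^ 4 - 3 * A ^ 4 * v₃ τ ^ 4)) * v₄ τ) τ
  deriv_eta : ∀ τ ∈ D, HasDerivAt h
    (I / (Real.pi : ℂ) * (2 * h τ ^ 2) - (Real.pi : ℂ) ^ 3 / 72 * I *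
      (v₃ τ ^ 8 + (9 * A ^ 4 * B ^ 4 - 6 * A ^ 4 - 6 * B ^ 4 + 2) * v₃ τ ^ 4 * v₄ τ ^ 4
        + v₄ τ ^ 8)) τ

/-- The transformed modulus `(a τ + b) / (c τ + δ)`. -/
noncomputable def mobius (a b c δ τ : ℂ) : ℂ := (a * τ + b) / (c * τ + δ)

/-- The complex constants `a, b, c, δ` have determinant `1`, the transformed modulus is defined and
lies in the upper half-plane for all `τ ∈ D`, and `s` is a continuous (hence, on an open set,
holomorphic) branch of `√(c τ + δ)` on `D`. -/
structure IsAdmissible (a b c δ : ℂ) (D : Set ℂ) (s : ℂ → ℂ) : Prop where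
  det_eq_one : a * δ - b * c = 1
  denom_ne_zero : ∀ τ ∈ D, c * τ + δ ≠ 0
  im_pos : ∀ τ ∈ D, 0 < (mobius a b c δ τ).im
  continuousOn_sqrt : ContinuousOn s D
  sqrt_sq : ∀ τ ∈ D, s τ ^ 2 = c * τ + δ

/-- `ϑ₂` of the general solution; `d` is a multiplicative constant, `s` a branch of `√(c τ + δ)`. -/
noncomputable def genTheta2 (a b c d δ : ℂ) (s : ℂ → ℂ) (τ : ℂ) : ℂ :=
  d * (theta2 (mobius a b c δ τ) / s τ)

/-- `ϑ₃` of the general solution. -/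
noncomputable def genTheta3 (A a b c δ : ℂ) (s : ℂ → ℂ) (τ : ℂ) : ℂ :=
  1 / A * (theta3 (mobius a b c δ τ) / s τ)

/-- `ϑ₄` of the general solution. -/
noncomputable def genTheta4 (B a b c δ : ℂ) (s : ℂ → ℂ) (τ : ℂ) : ℂ :=
  1 / B * (theta4 (mobius a b c δ τ) / s τ)

/-- `η` of the general solution. -/
noncomputable def genEta (A B a b c δ τ : ℂ) : ℂ :=
  1 / (c * τ + δ) ^ 2 *
      (weierstrassEta (mobius a b c δ τ) + (Real.pi : ℂ) ^ 2 / 12 *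
        ((1 - 1 / A ^ 4) * theta3 (mobius a b c δ τ) ^ 4
          + (1 - 1 / B ^ 4) * theta4 (mobius a b c δ τ) ^ 4))
    + 1 / 2 * ((Real.pi : ℂ) * I * c / (c * τ + δ))

end ThetaSystem

namespace ThetaSystem

open Filter Topology

/-! The constants `A`, `B` disappear in the variables `X = A⁴ϑ₃⁴`, `Y = B⁴ϑ₄⁴` and a shifted `η`,
called `E`: the triple `(X, Y, E)` follows the single polynomial field `quarticField`. The function
`ϑ₂` only enters through a linear equation of its own.

The canonical series satisfy their equations by modularity. The errors in the three logarithmic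
derivatives (`defect2`, `defect3`, `defect4`) are permuted, up to the weight factor, by `τ ↦ τ + 1`
and `τ ↦ -1/τ`. Their elementary symmetric functions are therefore cusp forms of level one and
weight 2, 4, 6, hence zero, and so are the errors. The equation for `η` has an error of weight 4,
which vanishes likewise. The field is covariant under Möbius maps of determinant one, whence the
direct part (`isSolution_gen`).

For the converse, the three free parameters of the Möbius map are fitted to the value of `(X, Y, E)`
at one point. This is possible because `ϑ₄/ϑ₃` takes on the half-plane every value `w` with `w ≠ 0`
and `w⁴ ≠ 1` (`isThetaQuotient_of_ne`). Uniqueness for ordinary differential equations gives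
equality near that point. It spreads over `D` (`eq_quarticMobius_of_isPreconnected`) because `T`
cannot reach the real line inside `D`: the product `XY(X - Y)` never vanishes, so the modular
invariant of the solution is locally bounded, and this bounds `Im T` and `|cτ + δ|` from below. The
roots `ϑ₃`, `ϑ₄` and the function `ϑ₂` are then recovered from the choice of square root and from
linear equations. -/

/-! ### Theta series and their transformation laws -/

lemma theta3_eq_jacobiTheta (τ : ℂ) : theta3 τ = jacobiTheta τ :=
  tsum_congr fun k => by ring_nf

lemma theta3_eq_jacobiTheta₂ (τ : ℂ) : theta3 τ = jacobiTheta₂ 0 τ := by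
  rw [theta3_eq_jacobiTheta, jacobiTheta_eq_jacobiTheta₂]

lemma cexp_int_mul_pi_mul_I (k : ℤ) : cexp (k * (Real.pi * I)) = (-1 : ℂ) ^ k := by
  rw [exp_int_mul, exp_pi_mul_I]

lemma theta4_eq_jacobiTheta₂ (τ : ℂ) : theta4 τ = jacobiTheta₂ (1 / 2) τ := by
  refine tsum_congr fun k => ?_
  rw [← cexp_int_mul_pi_mul_I, ← Complex.exp_add, jacobiTheta₂_term]
  ring_nf

lemma theta2_eq_jacobiTheta₂ (τ : ℂ) :
    theta2 τ = cexp (Real.pi * I * τ / 4) * jacobiTheta₂ (τ / 2) τ := by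
  rw [jacobiTheta₂, ← tsum_mul_left]
  refine tsum_congr fun k => ?_
  rw [jacobiTheta₂_term, ← Complex.exp_add]
  ring_nf

lemma neg_one_zpow_eq_cexp_sq (k : ℤ) :
    cexp ((k : ℂ) ^ 2 * Real.pi * I) = (-1 : ℂ) ^ k := by
  rw [show (k : ℂ) ^ 2 * Real.pi * I = ((k ^ 2 : ℤ) : ℂ) * (Real.pi * I) by push_cast; ring,
    cexp_int_mul_pi_mul_I]
  rcases Int.even_or_odd k with h | h
  · rw [h.neg_one_zpow, (h.pow_of_ne_zero two_ne_zero).neg_one_zpow]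
  · rw [h.neg_one_zpow, h.pow.neg_one_zpow]

lemma theta3_add_one (τ : ℂ) : theta3 (τ + 1) = theta4 τ := by
  refine tsum_congr fun k => ?_
  rw [← neg_one_zpow_eq_cexp_sq, ← Complex.exp_add]
  ring_nf

lemma theta4_add_one (τ : ℂ) : theta4 (τ + 1) = theta3 τ := by
  rw [← theta3_add_one, theta3_eq_jacobiTheta, theta3_eq_jacobiTheta, ← jacobiTheta_two_add τ]
  ring_nf

lemma theta2_add_one (τ : ℂ) : theta2 (τ + 1) = cexp (Real.pi * I / 4) * theta2 τ := by
  rw [theta2, theta2, ← tsum_mul_left]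
  refine tsum_congr fun k => ?_
  -- Since `(k + 1/2)² = k² + k + 1/4` and `k² + k` is even, only the factor `e^{πi/4}` survives.
  rw [show ((k : ℂ) + 1 / 2) ^ 2 * Real.pi * I * (τ + 1) =
    ((k : ℂ) + 1 / 2) ^ 2 * Real.pi * I * τ + (k : ℂ) ^ 2 * Real.pi * I + k * (Real.pi * I)
      + Real.pi * I / 4 by ring, Complex.exp_add, Complex.exp_add, Complex.exp_add,
    neg_one_zpow_eq_cexp_sq, cexp_int_mul_pi_mul_I]
  have : (-1 : ℂ) ^ k * (-1 : ℂ) ^ k = 1 := by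
    rw [← mul_zpow]; simp
  linear_combination (cexp (Real.pi * I / 4) * cexp (((k : ℂ) + 1 / 2) ^ 2 * Real.pi * I * τ)) * this

/-- The automorphy factor `√(-iτ)` of weight one half. -/
noncomputable def halfFactor (τ : ℂ) : ℂ := (-I * τ) ^ (1 / 2 : ℂ)

lemma halfFactor_sq (τ : ℂ) : halfFactor τ ^ 2 = -I * τ := by
  rw [halfFactor, ← cpow_nat_mul]; simp

lemma ne_zero_of_im_pos {τ : ℂ} (h : 0 < τ.im) : τ ≠ 0 := by
  rintro rfl; simp at h

lemma halfFactor_ne_zero {τ : ℂ} (h : 0 < τ.im) : halfFactor τ ≠ 0 := by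
  intro h0
  have := halfFactor_sq τ
  rw [h0] at this
  simp [ne_zero_of_im_pos h] at this

lemma im_neg_one_div_pos {τ : ℂ} (h : 0 < τ.im) : 0 < (-1 / τ).im := by
  rw [neg_div, neg_im, one_div, inv_im, neg_div, neg_neg]
  exact div_pos h (normSq_pos.mpr (ne_zero_of_im_pos h))

lemma theta3_neg_one_div {τ : ℂ} (h : 0 < τ.im) :
    theta3 (-1 / τ) = halfFactor τ * theta3 τ := by
  have := jacobiTheta₂_functional_equation 0 τ
  rw [theta3_eq_jacobiTheta₂, theta3_eq_jacobiTheta₂, this]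
  change _ = halfFactor τ * (1 / halfFactor τ * _ * _)
  have h2 := halfFactor_ne_zero h
  simp [h2]

lemma theta4_neg_one_div {τ : ℂ} (h : 0 < τ.im) :
    theta4 (-1 / τ) = halfFactor τ * theta2 τ := by
  have h0 := ne_zero_of_im_pos h
  have := jacobiTheta₂_functional_equation (τ / 2) τ
  rw [show τ / 2 / τ = 1 / 2 by field_simp] at this
  rw [theta4_eq_jacobiTheta₂, theta2_eq_jacobiTheta₂, this]
  change _ = halfFactor τ * (_ * (1 / halfFactor τ * _ * _))
  have h2 := halfFactor_ne_zero h
  have h3 : cexp (Real.pi * I * τ / 4) * cexp (-Real.pi * I * (τ / 2) ^ 2 / τ) = 1 := by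
    rw [← Complex.exp_add]
    convert Complex.exp_zero using 2
    field_simp; ring
  generalize jacobiTheta₂ (1 / 2) (-1 / τ) = J at *
  generalize cexp (Real.pi * I * τ / 4) = a at *
  generalize cexp (-Real.pi * I * (τ / 2) ^ 2 / τ) = b at *
  field_simp
  linear_combination -J * h3

lemma neg_one_div_neg_one_div {τ : ℂ} : -1 / (-1 / τ) = τ := by
  rcases eq_or_ne τ 0 with rfl | h
  · simp
  · field_simp

/-- The principal root commutes with inversion here, because `-iτ` has positive real part and so
stays off the cut. -/
lemma halfFactor_mul_halfFactor_neg_one_div {τ : ℂ} (h : 0 < τ.im) :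
    halfFactor (-1 / τ) * halfFactor τ = 1 := by
  have h0 := ne_zero_of_im_pos h
  have hre : 0 < (-I * τ).re := by simpa using h
  have key : -I * (-1 / τ) = (-I * τ)⁻¹ := by
    field_simp
    linear_combination I_sq
  have harg : (-I * τ).arg ≠ Real.pi := by
    intro h
    rw [Complex.arg_eq_pi_iff] at h
    linarith [h.1]
  rw [halfFactor, key, inv_cpow _ _ harg]
  exact inv_mul_cancel₀ (halfFactor_ne_zero h)

lemma theta2_neg_one_div {τ : ℂ} (h : 0 < τ.im) :
    theta2 (-1 / τ) = halfFactor τ * theta4 τ := by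
  have h1 := theta4_neg_one_div (im_neg_one_div_pos h)
  rw [neg_one_div_neg_one_div] at h1
  rw [h1, ← mul_assoc, mul_comm (halfFactor τ), halfFactor_mul_halfFactor_neg_one_div h, one_mul]

lemma differentiableAt_theta3 {τ : ℂ} (h : 0 < τ.im) : DifferentiableAt ℂ theta3 τ := by
  rw [show theta3 = jacobiTheta from funext theta3_eq_jacobiTheta]
  exact differentiableAt_jacobiTheta h

lemma differentiableAt_theta4 {τ : ℂ} (h : 0 < τ.im) : DifferentiableAt ℂ theta4 τ := by
  rw [show theta4 = jacobiTheta₂ (1 / 2) from funext theta4_eq_jacobiTheta₂]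
  exact differentiableAt_jacobiTheta₂_snd _ h

lemma differentiableAt_jacobiTheta₂_half_mul {τ : ℂ} (h : 0 < τ.im) :
    DifferentiableAt ℂ (fun t : ℂ => jacobiTheta₂ (t / 2) t) τ := by
  have h1 : DifferentiableAt ℂ (fun p : ℂ × ℂ => jacobiTheta₂ p.1 p.2) ((fun t : ℂ => (t / 2, t)) τ) :=
    (hasFDerivAt_jacobiTheta₂ (τ / 2) h).differentiableAt
  have h2 : DifferentiableAt ℂ (fun t : ℂ => (t / 2, t)) τ := by fun_prop
  exact DifferentiableAt.comp (f := fun t : ℂ => (t / 2, t))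
    (g := fun p : ℂ × ℂ => jacobiTheta₂ p.1 p.2) τ h1 h2

lemma differentiableAt_theta2 {τ : ℂ} (h : 0 < τ.im) : DifferentiableAt ℂ theta2 τ := by
  rw [show theta2 = fun t => cexp (Real.pi * I * t / 4) * jacobiTheta₂ (t / 2) t from
    funext theta2_eq_jacobiTheta₂]
  have := differentiableAt_jacobiTheta₂_half_mul h
  fun_prop

/-! ### Behaviour at the cusp -/

/-- The filter of neighbourhoods of `i∞` in `ℂ`. -/
abbrev imInfty : Filter ℂ := comap im atTop

lemma eventually_im_gt (c : ℝ) : ∀ᶠ τ in imInfty, c < τ.im :=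
  (eventually_gt_atTop c).comap im

lemma eventually_im_pos : ∀ᶠ τ in imInfty, 0 < τ.im := eventually_im_gt 0

lemma tendsto_add_one_imInfty : Tendsto (fun τ : ℂ => τ + 1) imInfty imInfty := by
  rw [tendsto_comap_iff]
  have : (im ∘ fun τ : ℂ => τ + 1) = im := by ext τ; simp
  rw [this]
  exact tendsto_comap

lemma tendsto_theta3_imInfty : Tendsto theta3 imInfty (𝓝 1) := by
  rw [show theta3 = jacobiTheta from funext theta3_eq_jacobiTheta]
  have h := isBigO_at_im_infty_jacobiTheta_sub_one
  have h2 : Tendsto (fun τ : ℂ => Real.exp (-Real.pi * τ.im)) imInfty (𝓝 0) := by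
    refine (Real.tendsto_exp_atBot.comp ?_)
    exact (tendsto_id.const_mul_atTop_of_neg (by linarith [Real.pi_pos])).comp tendsto_comap
  have := (h.trans_tendsto h2).add_const 1
  simpa using this

lemma tendsto_theta4_imInfty : Tendsto theta4 imInfty (𝓝 1) := by
  rw [show theta4 = fun τ => theta3 (τ + 1) from funext fun τ => (theta3_add_one τ).symm]
  exact tendsto_theta3_imInfty.comp tendsto_add_one_imInfty

lemma norm_jacobiTheta₂_term_half_mul (n : ℤ) (τ : ℂ) :
    ‖jacobiTheta₂_term n (τ / 2) τ‖ = Real.exp (-(Real.pi * (n ^ 2 + n) * τ.im)) := by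
  rw [jacobiTheta₂_term, Complex.norm_exp]
  congr 1
  rw [show 2 * (Real.pi : ℂ) * I * n * (τ / 2) + Real.pi * I * n ^ 2 * τ
    = ((Real.pi * (n ^ 2 + n) : ℝ) : ℂ) * (I * τ) by push_cast; ring, re_ofReal_mul]
  simp

/-- The `n`-th term has modulus `e^{-π(n² + n) Im τ}`, so only `n = 0` and `n = -1` survive, each
contributing 1. This is `ϑ₂` stripped of its leading factor `e^{πiτ/4}`. -/
lemma tendsto_jacobiTheta₂_half_mul_imInfty :
    Tendsto (fun τ : ℂ => jacobiTheta₂ (τ / 2) τ) imInfty (𝓝 2) := by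
  have hsum : ∑' n : ℤ, (if n ∈ ({0, -1} : Finset ℤ) then (1 : ℂ) else 0) = 2 := by
    rw [tsum_eq_sum (s := ({0, -1} : Finset ℤ))]
    · rw [Finset.sum_congr rfl fun x hx => if_pos hx]; simp
    · intro b hb
      rw [if_neg hb]
  have key := tendsto_tsum_of_dominated_convergence (𝓕 := imInfty)
    (f := fun (τ : ℂ) (n : ℤ) => jacobiTheta₂_term n (τ / 2) τ)
    (g := fun n : ℤ => if n ∈ ({0, -1} : Finset ℤ) then (1 : ℂ) else 0)
    (bound := fun n => ‖jacobiTheta₂_term n (I / 2) I‖) ?_ ?_ ?_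
  · rwa [hsum] at key
  · exact ((summable_jacobiTheta₂_term_iff (I / 2) I).mpr (by simp)).norm
  · intro n
    split_ifs with hn
    · refine tendsto_const_nhds.congr fun τ => ?_
      simp only [Finset.mem_insert, Finset.mem_singleton] at hn
      rcases hn with rfl | rfl
      · simp [jacobiTheta₂_term]
      · rw [jacobiTheta₂_term, eq_comm]
        convert Complex.exp_zero using 2
        push_cast; ring
    · rw [tendsto_zero_iff_norm_tendsto_zero]
      simp_rw [norm_jacobiTheta₂_term_half_mul]
      have hpos : (0 : ℝ) < n ^ 2 + n := by
        simp only [Finset.mem_insert, Finset.mem_singleton, not_or] at hn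
        have : 0 < n ^ 2 + n := by
          rcases lt_or_ge n 0 with h | h
          · have : n + 1 < 0 := by omega
            nlinarith
          · have : 0 < n := by omega
            positivity
        exact_mod_cast this
      refine Real.tendsto_exp_neg_atTop_nhds_zero.comp ?_
      exact (tendsto_id.const_mul_atTop (mul_pos Real.pi_pos hpos)).comp tendsto_comap
  · filter_upwards [eventually_im_gt 1] with τ hτ n
    rw [norm_jacobiTheta₂_term_half_mul, norm_jacobiTheta₂_term_half_mul, Real.exp_le_exp]
    have hn : (0 : ℝ) ≤ n ^ 2 + n := by
      have : 0 ≤ n ^ 2 + n := by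
        rcases lt_or_ge n 0 with h | h
        · have : n + 1 ≤ 0 := by omega
          nlinarith
        · positivity
      exact_mod_cast this
    have := mul_nonneg Real.pi_pos.le hn
    rw [I_im, neg_le_neg_iff]
    exact mul_le_mul_of_nonneg_left hτ.le this

lemma tendsto_cexp_imInfty {c : ℝ} (hc : 0 < c) :
    Tendsto (fun τ : ℂ => cexp (c * I * τ)) imInfty (𝓝 0) := by
  rw [tendsto_zero_iff_norm_tendsto_zero]
  have : (fun τ : ℂ => ‖cexp (c * I * τ)‖) = fun τ : ℂ => Real.exp (-(c * τ.im)) := by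
    ext τ
    rw [Complex.norm_exp, mul_assoc, re_ofReal_mul]
    simp
  rw [this]
  refine Real.tendsto_exp_neg_atTop_nhds_zero.comp ?_
  exact (tendsto_id.const_mul_atTop hc).comp tendsto_comap

lemma tendsto_theta2_imInfty : Tendsto theta2 imInfty (𝓝 0) := by
  have h := (tendsto_cexp_imInfty (c := Real.pi / 4) (by positivity)).mul
    tendsto_jacobiTheta₂_half_mul_imInfty
  rw [zero_mul] at h
  refine h.congr fun τ => ?_
  rw [theta2_eq_jacobiTheta₂]
  push_cast
  ring_nf

/-! ### Cusp forms of level one -/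

open scoped UpperHalfPlane MatrixGroups ModularForm Manifold

lemma coe_S_smul (z : ℍ) : ((ModularGroup.S • z : ℍ) : ℂ) = -1 / z := by
  rw [UpperHalfPlane.modular_S_smul, UpperHalfPlane.coe_mk, inv_neg, neg_div, one_div]

lemma coe_T_smul (z : ℍ) : ((ModularGroup.T • z : ℍ) : ℂ) = z + 1 := by
  rw [UpperHalfPlane.modular_T_smul, UpperHalfPlane.coe_vadd, ofReal_one, add_comm]

lemma denom_S (z : ℍ) : UpperHalfPlane.denom ModularGroup.S z = z := by
  rw [ModularGroup.denom_apply]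
  simp [ModularGroup.S]

lemma denom_T (z : ℍ) : UpperHalfPlane.denom ModularGroup.T z = 1 := by
  rw [ModularGroup.denom_apply]
  simp [ModularGroup.T]

/-- Invariance under the two generators gives invariance under the slash action. -/
lemma slash_eq_of_generators {f : ℂ → ℂ} {k : ℤ} (hT : ∀ τ : ℂ, 0 < τ.im → f (τ + 1) = f τ)
    (hS : ∀ τ : ℂ, 0 < τ.im → f (-1 / τ) = τ ^ k * f τ) (γ : SL(2, ℤ)) :
    (fun z : ℍ => f z) ∣[k] γ = fun z : ℍ => f z := by
  refine SlashInvariantForm.slash_action_generators_SL2Z ?_ ?_ γ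
  · ext z
    rw [SlashInvariantForm.slash_S_apply]
    have := hS z z.2
    have h0 := ne_zero_of_im_pos z.2
    have e : ((ModularGroup.S • z : ℍ) : ℂ) = -1 / z := coe_S_smul z
    rw [UpperHalfPlane.modular_S_smul] at e
    rw [e, this, mul_comm, ← mul_assoc, ← zpow_add₀ h0]
    simp
  · ext z
    rw [ModularForm.SL_slash_apply, coe_T_smul, hT z z.2]
    simp [denom_T]

lemma apply_smul_of_generators {f : ℂ → ℂ} {k : ℤ} (hT : ∀ τ : ℂ, 0 < τ.im → f (τ + 1) = f τ)
    (hS : ∀ τ : ℂ, 0 < τ.im → f (-1 / τ) = τ ^ k * f τ) (γ : SL(2, ℤ)) (z : ℍ) :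
    f (γ • z : ℍ) = UpperHalfPlane.denom γ z ^ k * f z := by
  have := congrFun (slash_eq_of_generators hT hS γ) z
  rw [ModularForm.SL_slash_apply] at this
  rw [← this, mul_comm, mul_assoc, ← zpow_add₀ (UpperHalfPlane.denom_ne_zero _ z)]
  simp

/-- A cusp form of level one from a function on the half-plane. -/
noncomputable def cuspFormOfGenerators (f : ℂ → ℂ) (k : ℤ)
    (hd : ∀ τ : ℂ, 0 < τ.im → DifferentiableAt ℂ f τ)
    (hT : ∀ τ : ℂ, 0 < τ.im → f (τ + 1) = f τ)
    (hS : ∀ τ : ℂ, 0 < τ.im → f (-1 / τ) = τ ^ k * f τ)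
    (h0 : Tendsto f imInfty (𝓝 0)) : CuspForm 𝒮ℒ k where
  toFun := fun z => f z
  slash_action_eq' A hA := by
    obtain ⟨A, rfl⟩ := hA
    exact slash_eq_of_generators hT hS A
  holo' := by
    rw [UpperHalfPlane.mdifferentiable_iff]
    refine DifferentiableOn.congr (f := f) (fun z hz => (hd z hz).differentiableWithinAt) ?_
    intro z hz
    simp [UpperHalfPlane.ofComplex_apply_of_im_pos hz]
  zero_at_cusps' hc := by
    rw [Subgroup.IsArithmetic.isCusp_iff_isCusp_SL2Z] at hc
    rw [OnePoint.isZeroAt_iff_forall_SL2Z hc]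
    -- Every cusp is carried to infinity by some `γ`, and the function is invariant under `γ`, so
    -- decay at `i∞` suffices.
    intro γ _
    rw [slash_eq_of_generators hT hS]
    exact h0.comp UpperHalfPlane.tendsto_coe_atImInfty

lemma eq_zero_of_weight_lt_twelve {f : ℂ → ℂ} {k : ℤ} (hk : k < 12)
    (hd : ∀ τ : ℂ, 0 < τ.im → DifferentiableAt ℂ f τ)
    (hT : ∀ τ : ℂ, 0 < τ.im → f (τ + 1) = f τ)
    (hS : ∀ τ : ℂ, 0 < τ.im → f (-1 / τ) = τ ^ k * f τ)
    (h0 : Tendsto f imInfty (𝓝 0)) {τ : ℂ} (hτ : 0 < τ.im) : f τ = 0 := by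
  have h := rank_zero_iff_forall_zero.mp (CuspForm.rank_eq_zero_of_weight_lt_twelve hk)
    (cuspFormOfGenerators f k hd hT hS h0)
  exact congrArg (fun g : CuspForm 𝒮ℒ k => g ⟨τ, hτ⟩) h

lemma exists_eq_smul_discriminant {f : ℂ → ℂ}
    (hd : ∀ τ : ℂ, 0 < τ.im → DifferentiableAt ℂ f τ)
    (hT : ∀ τ : ℂ, 0 < τ.im → f (τ + 1) = f τ)
    (hS : ∀ τ : ℂ, 0 < τ.im → f (-1 / τ) = τ ^ (12 : ℤ) * f τ)
    (h0 : Tendsto f imInfty (𝓝 0)) :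
    ∃ c : ℂ, ∀ z : ℍ, f z = c * ModularForm.discriminant z := by
  obtain ⟨c, hc⟩ := CuspForm.exists_smul_discriminant_of_weight_eq_twelve
    (cuspFormOfGenerators f 12 hd hT hS h0)
  exact ⟨c, fun z => (congrArg (fun g : CuspForm 𝒮ℒ 12 => g z) hc).symm⟩

/-- The derivative of a function with a limit at `i∞` tends to zero there. -/
lemma tendsto_deriv_imInfty {f : ℂ → ℂ} {L : ℂ}
    (hd : ∀ τ : ℂ, 0 < τ.im → DifferentiableAt ℂ f τ) (hf : Tendsto f imInfty (𝓝 L)) :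
    Tendsto (deriv f) imInfty (𝓝 0) := by
  rw [Metric.tendsto_nhds] at hf ⊢
  intro ε hε
  obtain ⟨M, hM⟩ := eventually_atTop.mp (eventually_comap.mp (hf (ε / 2) (by positivity)))
  filter_upwards [eventually_im_gt (max M 0 + 1)] with τ hτ
  have him : ∀ z ∈ Metric.closedBall τ 1, max M 0 < z.im := by
    intro z hz
    have h1 : |(z - τ).im| ≤ 1 := (abs_im_le_norm _).trans (by simpa [dist_eq_norm] using hz)
    rw [sub_im] at h1
    linarith [(abs_le.mp h1).1]
  -- Cauchy's estimate on the unit circle around `τ`, where `f - L` is at most `ε / 2`.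
  have hle : ‖deriv (fun z => f z - L) τ‖ ≤ (ε / 2) / 1 := by
    refine Complex.norm_deriv_le_of_forall_mem_sphere_norm_le one_pos ?_ ?_
    · refine DifferentiableOn.diffContOnCl fun z hz => ?_
      rw [closure_ball _ one_ne_zero] at hz
      exact ((hd z ((le_max_right _ _).trans_lt (him z hz))).sub_const L).differentiableWithinAt
    · intro z hz
      have := hM z.im ((le_max_left _ _).trans (him z (Metric.sphere_subset_closedBall hz)).le) z rfl
      rw [dist_eq_norm] at this
      exact this.le
  rw [deriv_sub_const] at hle
  rw [dist_zero_right]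
  linarith

/-! ### The function `η` as a quasimodular form -/

open EisensteinSeries ArithmeticFunction

/-- The divisor sum in the expansion of `E2` is a Lambert series: `∑ c xᶜ = x / (1 - x)²` is summed
over `x = q^d`. -/
lemma weierstrassEta_eq_E2 (z : ℍ) : weierstrassEta z = (Real.pi : ℂ) ^ 2 / 12 * E2 z := by
  have hq : ‖cexp (2 * Real.pi * I * z)‖ < 1 := by
    rw [Complex.norm_exp, Real.exp_lt_one_iff]
    have := mul_pos Real.pi_pos z.2
    have e : (2 * Real.pi * I * (z : ℂ)).re = -(2 * (Real.pi * (z : ℂ).im)) := by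
      simp; ring
    rw [e]
    linarith
  rw [E2_eq_tsum_cexp, weierstrassEta]
  rw [← tsum_prod_pow_eq_tsum_sigma 1 hq]
  have hterm : ∀ d : ℕ+, ∑' c : ℕ+, (c : ℂ) ^ 1 * cexp (2 * Real.pi * I * z) ^ (d * c : ℕ) =
      cexp (2 * Real.pi * I * z) ^ (d : ℕ) / (1 - cexp (2 * Real.pi * I * z) ^ (d : ℕ)) ^ 2 := by
    intro d
    have hd : ‖cexp (2 * Real.pi * I * z) ^ (d : ℕ)‖ < 1 := by
      rw [norm_pow]
      exact pow_lt_one₀ (norm_nonneg _) hq d.ne_zero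
    rw [← tsum_coe_mul_geometric_of_norm_lt_one hd]
    have := tsum_pnat_eq_tsum_succ (f := fun n : ℕ => (n : ℂ) * (cexp (2 * Real.pi * I * z) ^ (d : ℕ)) ^ n)
    rw [Summable.tsum_eq_zero_add (hasSum_coe_mul_geometric_of_norm_lt_one hd).summable, ← this]
    simp [pow_mul]
  simp_rw [hterm]
  rw [tsum_pnat_eq_tsum_succ (f := fun n : ℕ => cexp (2 * Real.pi * I * z) ^ n /
    (1 - cexp (2 * Real.pi * I * z) ^ n) ^ 2)]
  have : ∀ k : ℕ, cexp (2 * Real.pi * I * z) ^ (k + 1) = cexp (2 * ((k : ℂ) + 1) * Real.pi * I * z) := by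
    intro k
    rw [← Complex.exp_nat_mul]
    push_cast
    ring_nf
  simp_rw [this]
  ring

lemma differentiableAt_weierstrassEta {τ : ℂ} (h : 0 < τ.im) :
    DifferentiableAt ℂ weierstrassEta τ := by
  have h1 := (UpperHalfPlane.mdifferentiable_iff.mp E2_mdifferentiable).differentiableAt
    (UpperHalfPlane.isOpen_upperHalfPlaneSet.mem_nhds h)
  refine (h1.const_mul ((Real.pi : ℂ) ^ 2 / 12)).congr_of_eventuallyEq ?_
  filter_upwards [UpperHalfPlane.isOpen_upperHalfPlaneSet.mem_nhds h] with t ht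
  have := weierstrassEta_eq_E2 ⟨t, ht⟩
  simp only [Function.comp_apply, UpperHalfPlane.ofComplex_apply_of_im_pos ht]
  exact this

lemma weierstrassEta_smul (γ : SL(2, ℤ)) (z : ℍ) :
    weierstrassEta (γ • z : ℍ) = UpperHalfPlane.denom γ z ^ 2 * weierstrassEta z
      - Real.pi * I / 2 * (γ 1 0 : ℂ) * UpperHalfPlane.denom γ z := by
  have h := congrFun (E2_slash_action γ) z
  have h0 := UpperHalfPlane.denom_ne_zero γ z
  rw [ModularForm.SL_slash_apply] at h
  simp only [Pi.sub_apply, Pi.smul_apply, smul_eq_mul, D2, riemannZeta_two] at h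
  rw [weierstrassEta_eq_E2, weierstrassEta_eq_E2]
  have hp : (Real.pi : ℂ) ≠ 0 := ofReal_ne_zero.mpr Real.pi_ne_zero
  rw [zpow_neg, ← div_eq_mul_inv, div_eq_iff (zpow_ne_zero _ h0)] at h
  rw [h]
  simp only [zpow_ofNat]
  field_simp
  ring

lemma weierstrassEta_add_one (τ : ℂ) :
    weierstrassEta (τ + 1) = weierstrassEta τ := by
  refine congrArg (fun x => 2 * (Real.pi : ℂ) ^ 2 * (1 / 24 - x)) (tsum_congr fun k => ?_)
  have : cexp (2 * ((k : ℂ) + 1) * Real.pi * I * (τ + 1)) = cexp (2 * ((k : ℂ) + 1) * Real.pi * I * τ) := by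
    rw [Complex.exp_eq_exp_iff_exists_int]
    exact ⟨k + 1, by push_cast; ring⟩
  rw [this]

lemma weierstrassEta_neg_one_div {τ : ℂ} (h : 0 < τ.im) :
    weierstrassEta (-1 / τ) = τ ^ 2 * weierstrassEta τ - Real.pi * I / 2 * τ := by
  have := weierstrassEta_smul ModularGroup.S ⟨τ, h⟩
  rw [coe_S_smul, denom_S] at this
  simpa [ModularGroup.S] using this

lemma tendsto_weierstrassEta_imInfty :
    Tendsto weierstrassEta imInfty (𝓝 ((Real.pi : ℂ) ^ 2 / 12)) := by
  have hr : Real.exp (-(2 * Real.pi)) < 1 := Real.exp_lt_one_iff.mpr (by linarith [Real.pi_pos])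
  have hr0 := Real.exp_pos (-(2 * Real.pi))
  set r := Real.exp (-(2 * Real.pi)) with hrdef
  have hc : ∀ k : ℕ, (0 : ℝ) < 2 * (k + 1) * Real.pi := fun k => by
    have := Real.pi_pos; positivity
  have hexp : ∀ k : ℕ, Tendsto
      (fun τ : ℂ => cexp (2 * ((k : ℂ) + 1) * (Real.pi : ℂ) * I * τ)) imInfty (𝓝 0) := fun k => by
    have := tendsto_cexp_imInfty (hc k)
    push_cast at this
    exact this
  have key := tendsto_tsum_of_dominated_convergence (𝓕 := imInfty)
    (f := fun (τ : ℂ) (k : ℕ) => cexp (2 * ((k : ℂ) + 1) * (Real.pi : ℂ) * I * τ) /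
      (1 - cexp (2 * ((k : ℂ) + 1) * (Real.pi : ℂ) * I * τ)) ^ 2)
    (g := fun _ => 0) (bound := fun k => r ^ k / (1 - r) ^ 2)
    ((summable_geometric_of_lt_one hr0.le hr).div_const _) ?_ ?_
  · rw [tsum_zero] at key
    have h2 := (key.const_sub (1 / 24 : ℂ)).const_mul (2 * (Real.pi : ℂ) ^ 2)
    rw [show 2 * (Real.pi : ℂ) ^ 2 * (1 / 24 - 0) = (Real.pi : ℂ) ^ 2 / 12 by ring] at h2
    exact h2
  · intro k
    have h := (hexp k).div (((hexp k).const_sub 1).pow 2) (by simp)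
    simp only [sub_zero, zero_div] at h
    exact h
  · filter_upwards [eventually_im_gt 1] with τ hτ k
    have hn : ‖cexp (2 * ((k : ℂ) + 1) * (Real.pi : ℂ) * I * τ)‖ ≤ r ^ (k + 1) := by
      rw [Complex.norm_exp, hrdef, ← Real.exp_nat_mul, Real.exp_le_exp]
      have e : (2 * ((k : ℂ) + 1) * (Real.pi : ℂ) * I * τ) =
        ((2 * (k + 1) * Real.pi : ℝ) : ℂ) * (I * τ) := by push_cast; ring
      rw [e, re_ofReal_mul]
      have := mul_le_mul_of_nonneg_left hτ.le (hc k).le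
      push_cast
      simp only [mul_re, I_re, I_im, zero_mul, one_mul, zero_sub]
      linarith
    have h1 : r ^ (k + 1) ≤ r := by
      simpa using pow_le_pow_of_le_one hr0.le hr.le (Nat.le_add_left 1 k)
    have h2 : r ^ (k + 1) ≤ r ^ k := pow_le_pow_of_le_one hr0.le hr.le (Nat.le_succ k)
    rw [norm_div, norm_pow]
    -- For `Im τ > 1` each exponential has modulus at most `r < 1`, which keeps the denominators
    -- above `(1 - r)²`.
    refine div_le_div₀ (by positivity) (hn.trans h2) (by nlinarith) ?_
    refine pow_le_pow_left₀ (by linarith) ?_ 2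
    have := norm_sub_norm_le 1 (cexp (2 * ((k : ℂ) + 1) * (Real.pi : ℂ) * I * τ))
    rw [norm_one] at this
    linarith

/-! ### Fourth powers, Jacobi's identity and non-vanishing -/

/-- The fourth powers `ϑ₂⁴`, `ϑ₃⁴`, `ϑ₄⁴`, of weight two. -/
noncomputable def theta2Four (τ : ℂ) : ℂ := theta2 τ ^ 4
noncomputable def theta3Four (τ : ℂ) : ℂ := theta3 τ ^ 4
noncomputable def theta4Four (τ : ℂ) : ℂ := theta4 τ ^ 4

lemma halfFactor_pow_four (τ : ℂ) : halfFactor τ ^ 4 = -τ ^ 2 := by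
  rw [show 4 = 2 * 2 from rfl, pow_mul, halfFactor_sq, mul_pow, neg_sq, I_sq]; ring

lemma theta3Four_neg_one_div {τ : ℂ} (h : 0 < τ.im) :
    theta3Four (-1 / τ) = -τ ^ 2 * theta3Four τ := by
  rw [theta3Four, theta3_neg_one_div h, mul_pow, halfFactor_pow_four, theta3Four]

lemma theta4Four_neg_one_div {τ : ℂ} (h : 0 < τ.im) :
    theta4Four (-1 / τ) = -τ ^ 2 * theta2Four τ := by
  rw [theta4Four, theta4_neg_one_div h, mul_pow, halfFactor_pow_four, theta2Four]

lemma theta2Four_neg_one_div {τ : ℂ} (h : 0 < τ.im) :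
    theta2Four (-1 / τ) = -τ ^ 2 * theta4Four τ := by
  rw [theta2Four, theta2_neg_one_div h, mul_pow, halfFactor_pow_four, theta4Four]

lemma theta3Four_add_one (τ : ℂ) : theta3Four (τ + 1) = theta4Four τ := by
  rw [theta3Four, theta3_add_one, theta4Four]

lemma theta4Four_add_one (τ : ℂ) : theta4Four (τ + 1) = theta3Four τ := by
  rw [theta4Four, theta4_add_one, theta3Four]

lemma theta2Four_add_one (τ : ℂ) : theta2Four (τ + 1) = -theta2Four τ := by
  rw [theta2Four, theta2_add_one, mul_pow, ← Complex.exp_nat_mul, theta2Four,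
    show ((4 : ℕ) : ℂ) * (Real.pi * I / 4) = Real.pi * I by push_cast; ring, exp_pi_mul_I]
  ring

lemma differentiableAt_theta2Four {τ : ℂ} (h : 0 < τ.im) : DifferentiableAt ℂ theta2Four τ :=
  (differentiableAt_theta2 h).pow 4

lemma differentiableAt_theta3Four {τ : ℂ} (h : 0 < τ.im) : DifferentiableAt ℂ theta3Four τ :=
  (differentiableAt_theta3 h).pow 4

lemma differentiableAt_theta4Four {τ : ℂ} (h : 0 < τ.im) : DifferentiableAt ℂ theta4Four τ :=
  (differentiableAt_theta4 h).pow 4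

lemma tendsto_theta2Four_imInfty : Tendsto theta2Four imInfty (𝓝 0) := by
  have := tendsto_theta2_imInfty.pow 4
  rwa [zero_pow four_ne_zero] at this

lemma tendsto_theta3Four_imInfty : Tendsto theta3Four imInfty (𝓝 1) := by
  have := tendsto_theta3_imInfty.pow 4
  rwa [one_pow] at this

lemma tendsto_theta4Four_imInfty : Tendsto theta4Four imInfty (𝓝 1) := by
  have := tendsto_theta4_imInfty.pow 4
  rwa [one_pow] at this

/-- Jacobi's identity `ϑ₃⁴ = ϑ₂⁴ + ϑ₄⁴`. -/
lemma theta3Four_eq {τ : ℂ} (h : 0 < τ.im) : theta3Four τ = theta2Four τ + theta4Four τ := by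
  -- The difference of the two sides only changes sign under the generators, apart from the weight
  -- factor; its square is an honest cusp form of weight 4.
  have key : (theta3Four τ - theta4Four τ - theta2Four τ) ^ 2 = 0 := by
    refine eq_zero_of_weight_lt_twelve
      (f := fun t => (theta3Four t - theta4Four t - theta2Four t) ^ 2) (k := 4) (by norm_num) ?_ ?_ ?_ ?_ h
    · intro t ht
      exact (((differentiableAt_theta3Four ht).sub (differentiableAt_theta4Four ht)).sub
        (differentiableAt_theta2Four ht)).pow 2
    · intro t _
      simp only [theta3Four_add_one, theta4Four_add_one, theta2Four_add_one]
      ring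
    · intro t ht
      simp only [theta3Four_neg_one_div ht, theta4Four_neg_one_div ht, theta2Four_neg_one_div ht]
      norm_cast
      ring
    · have := ((tendsto_theta3Four_imInfty.sub tendsto_theta4Four_imInfty).sub
        tendsto_theta2Four_imInfty).pow 2
      simpa using this
  have := pow_eq_zero_iff two_ne_zero |>.mp key
  linear_combination this

/-- The cusp form `(ϑ₂ϑ₃ϑ₄)⁸`. -/
noncomputable def thetaProd (τ : ℂ) : ℂ := (theta2Four τ * theta3Four τ * theta4Four τ) ^ 2

lemma differentiableAt_thetaProd {τ : ℂ} (h : 0 < τ.im) : DifferentiableAt ℂ thetaProd τ :=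
  (((differentiableAt_theta2Four h).mul (differentiableAt_theta3Four h)).mul
    (differentiableAt_theta4Four h)).pow 2

lemma thetaProd_add_one (τ : ℂ) : thetaProd (τ + 1) = thetaProd τ := by
  simp only [thetaProd, theta3Four_add_one, theta4Four_add_one, theta2Four_add_one]
  ring

lemma thetaProd_neg_one_div {τ : ℂ} (h : 0 < τ.im) :
    thetaProd (-1 / τ) = τ ^ (12 : ℤ) * thetaProd τ := by
  simp only [thetaProd, theta3Four_neg_one_div h, theta4Four_neg_one_div h,
    theta2Four_neg_one_div h]
  norm_cast
  ring

lemma tendsto_thetaProd_imInfty : Tendsto thetaProd imInfty (𝓝 0) := by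
  have := ((tendsto_theta2Four_imInfty.mul tendsto_theta3Four_imInfty).mul
    tendsto_theta4Four_imInfty).pow 2
  rw [show ((0 : ℂ) * 1 * 1) ^ 2 = 0 by norm_num] at this
  exact this

instance imInfty_neBot : imInfty.NeBot :=
  Filter.NeBot.comap_of_surj inferInstance im_surjective

/-- A cusp form of weight 12 is a multiple of the discriminant, which has no zeros. The multiple is
nonzero because none of the three theta series vanishes near `i∞`. -/
lemma thetaProd_ne_zero {τ : ℂ} (h : 0 < τ.im) : thetaProd τ ≠ 0 := by
  obtain ⟨c, hc⟩ := exists_eq_smul_discriminant (fun _ => differentiableAt_thetaProd)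
    (fun t _ => thetaProd_add_one t) (fun _ => thetaProd_neg_one_div) tendsto_thetaProd_imInfty
  have h1 := hc ⟨τ, h⟩
  simp only at h1
  rw [h1]
  refine mul_ne_zero ?_ (ModularForm.discriminant_ne_zero _)
  rintro rfl
  obtain ⟨t, ht, h3, h4, h2⟩ := (eventually_im_pos.and
    ((tendsto_theta3_imInfty.eventually_ne one_ne_zero).and
    ((tendsto_theta4_imInfty.eventually_ne one_ne_zero).and
    (tendsto_jacobiTheta₂_half_mul_imInfty.eventually_ne two_ne_zero)))).exists
  have h2' : theta2 t ≠ 0 := by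
    rw [theta2_eq_jacobiTheta₂]
    exact mul_ne_zero (Complex.exp_ne_zero _) h2
  have := hc ⟨t, ht⟩
  simp [thetaProd, theta2Four, theta3Four, theta4Four, h2', h3, h4] at this

lemma theta2_ne_zero {τ : ℂ} (h : 0 < τ.im) : theta2 τ ≠ 0 := fun h0 =>
  thetaProd_ne_zero h (by simp [thetaProd, theta2Four, h0])

lemma theta3_ne_zero {τ : ℂ} (h : 0 < τ.im) : theta3 τ ≠ 0 := fun h0 =>
  thetaProd_ne_zero h (by simp [thetaProd, theta3Four, h0])

lemma theta4_ne_zero {τ : ℂ} (h : 0 < τ.im) : theta4 τ ≠ 0 := fun h0 =>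
  thetaProd_ne_zero h (by simp [thetaProd, theta4Four, h0])

lemma theta2Four_ne_zero {τ : ℂ} (h : 0 < τ.im) : theta2Four τ ≠ 0 :=
  pow_ne_zero 4 (theta2_ne_zero h)

lemma theta3Four_ne_zero {τ : ℂ} (h : 0 < τ.im) : theta3Four τ ≠ 0 :=
  pow_ne_zero 4 (theta3_ne_zero h)

lemma theta4Four_ne_zero {τ : ℂ} (h : 0 < τ.im) : theta4Four τ ≠ 0 :=
  pow_ne_zero 4 (theta4_ne_zero h)

/-! ### Logarithmic derivatives of the theta series -/

lemma hasDerivAt_neg_one_div {τ : ℂ} (h : τ ≠ 0) :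
    HasDerivAt (fun t : ℂ => -1 / t) (1 / τ ^ 2) τ := by
  have := (hasDerivAt_inv h).const_mul (-1)
  refine (this.congr_deriv (by field_simp)).congr_of_eventuallyEq (Eventually.of_forall fun t => ?_)
  simp [div_eq_mul_inv]

lemma logDeriv_neg_one_div_of_weight_two {u v : ℂ → ℂ} {τ : ℂ} (h : 0 < τ.im)
    (huv : ∀ t : ℂ, 0 < t.im → u (-1 / t) = -t ^ 2 * v t)
    (hu : DifferentiableAt ℂ u (-1 / τ)) (hv : DifferentiableAt ℂ v τ) (hv0 : v τ ≠ 0) :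
    logDeriv u (-1 / τ) = τ ^ 2 * logDeriv v τ + 2 * τ := by
  have h0 := ne_zero_of_im_pos h
  have h1 : HasDerivAt (fun t : ℂ => u (-1 / t)) (deriv u (-1 / τ) * (1 / τ ^ 2)) τ :=
    HasDerivAt.comp (h₂ := u) τ hu.hasDerivAt (hasDerivAt_neg_one_div h0)
  have h2 : HasDerivAt (fun t : ℂ => -t ^ 2 * v t) (-(2 * τ) * v τ + -τ ^ 2 * deriv v τ) τ := by
    have := ((hasDerivAt_pow 2 τ).neg).mul hv.hasDerivAt
    refine this.congr_deriv ?_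
    simp
  have h3 := h1.unique (h2.congr_of_eventuallyEq (mem_of_superset
    (UpperHalfPlane.isOpen_upperHalfPlaneSet.mem_nhds h) fun t ht => huv t ht))
  rw [logDeriv_apply, logDeriv_apply, huv τ h]
  field_simp at h3 ⊢
  linear_combination -h3

lemma logDeriv_add_one {u v : ℂ → ℂ} {c : ℂ} (hc : c ≠ 0) (huv : ∀ t, u (t + 1) = c * v t)
    (τ : ℂ) : logDeriv u (τ + 1) = logDeriv v τ := by
  have : deriv u (τ + 1) = c * deriv v τ := by
    rw [← deriv_comp_add_const, show (fun t => u (t + 1)) = fun t => c * v t from funext huv,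
      deriv_const_mul_field]
  rw [logDeriv_apply, logDeriv_apply, this, huv, mul_div_mul_left _ _ hc]

lemma differentiableAt_logDeriv {u : ℂ → ℂ} (hu : ∀ t : ℂ, 0 < t.im → DifferentiableAt ℂ u t)
    {τ : ℂ} (h : 0 < τ.im) (h0 : u τ ≠ 0) : DifferentiableAt ℂ (logDeriv u) τ := by
  have hd : DifferentiableOn ℂ u UpperHalfPlane.upperHalfPlaneSet :=
    fun t ht => (hu t ht).differentiableWithinAt
  have := (hd.deriv UpperHalfPlane.isOpen_upperHalfPlaneSet).differentiableAt
    (UpperHalfPlane.isOpen_upperHalfPlaneSet.mem_nhds h)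
  exact this.div (hu τ h) h0

lemma tendsto_logDeriv_imInfty {f : ℂ → ℂ} {L : ℂ} (hL : L ≠ 0)
    (hd : ∀ τ : ℂ, 0 < τ.im → DifferentiableAt ℂ f τ) (hf : Tendsto f imInfty (𝓝 L)) :
    Tendsto (logDeriv f) imInfty (𝓝 0) := by
  have := (tendsto_deriv_imInfty hd hf).div hf hL
  rwa [zero_div] at this

/-- The factor `e^{πiτ}` of `ϑ₂⁴` contributes `πi`; the cofactor has the nonzero limit 16, so its
logarithmic derivative dies out. -/
lemma tendsto_logDeriv_theta2Four_imInfty :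
    Tendsto (logDeriv theta2Four) imInfty (𝓝 (Real.pi * I)) := by
  have hd : ∀ τ : ℂ, 0 < τ.im → DifferentiableAt ℂ (fun t : ℂ => jacobiTheta₂ (t / 2) t ^ 4) τ :=
    fun τ h => (differentiableAt_jacobiTheta₂_half_mul h).pow 4
  have h1 := (tendsto_logDeriv_imInfty (L := 2 ^ 4) (by norm_num) hd
    (tendsto_jacobiTheta₂_half_mul_imInfty.pow 4)).const_add (Real.pi * I)
  rw [add_zero] at h1
  refine h1.congr' ?_
  filter_upwards [eventually_im_pos] with τ hτ
  have e : theta2Four = fun t => cexp (Real.pi * I * t) * jacobiTheta₂ (t / 2) t ^ 4 := by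
    ext t
    rw [theta2Four, theta2_eq_jacobiTheta₂, mul_pow, ← Complex.exp_nat_mul]
    push_cast
    ring_nf
  have hne : jacobiTheta₂ (τ / 2) τ ≠ 0 := by
    have := theta2_ne_zero hτ
    rw [theta2_eq_jacobiTheta₂] at this
    exact right_ne_zero_of_mul this
  rw [e, logDeriv_mul (f := fun t => cexp (Real.pi * I * t)) (g := fun t => jacobiTheta₂ (t / 2) t ^ 4)
    τ (Complex.exp_ne_zero _) (pow_ne_zero 4 hne) (by fun_prop) (hd τ hτ)]
  congr 1
  have : HasDerivAt (fun t : ℂ => cexp (Real.pi * I * t)) (cexp (Real.pi * I * τ) * (Real.pi * I)) τ := by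
    simpa using ((hasDerivAt_id τ).const_mul (Real.pi * I : ℂ)).cexp
  rw [logDeriv_apply, this.deriv, mul_div_cancel_left₀ _ (Complex.exp_ne_zero _)]

/-- The defects of the logarithmic derivatives of `ϑ₂⁴`, `ϑ₃⁴`, `ϑ₄⁴`. -/
noncomputable def defect2 (τ : ℂ) : ℂ := logDeriv theta2Four τ - 4 * I / Real.pi *
  (weierstrassEta τ + (Real.pi : ℂ) ^ 2 / 12 * (theta3Four τ + theta4Four τ))
noncomputable def defect3 (τ : ℂ) : ℂ := logDeriv theta3Four τ - 4 * I / Real.pi *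
  (weierstrassEta τ + (Real.pi : ℂ) ^ 2 / 12 * (theta2Four τ - theta4Four τ))
noncomputable def defect4 (τ : ℂ) : ℂ := logDeriv theta4Four τ - 4 * I / Real.pi *
  (weierstrassEta τ - (Real.pi : ℂ) ^ 2 / 12 * (theta3Four τ + theta2Four τ))

lemma defect2_add_one (τ : ℂ) : defect2 (τ + 1) = defect2 τ := by
  rw [defect2, defect2, logDeriv_add_one (c := -1) (by simp) (fun t => by
    rw [theta2Four_add_one]; ring), theta3Four_add_one, theta4Four_add_one,
    weierstrassEta_add_one, add_comm (theta3Four τ)]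

lemma defect3_add_one (τ : ℂ) : defect3 (τ + 1) = defect4 τ := by
  rw [defect3, defect4, logDeriv_add_one (c := 1) (by simp) (fun t => by
    rw [theta3Four_add_one, one_mul]), theta2Four_add_one, theta4Four_add_one,
    weierstrassEta_add_one]
  ring

lemma defect4_add_one (τ : ℂ) : defect4 (τ + 1) = defect3 τ := by
  rw [defect3, defect4, logDeriv_add_one (c := 1) (by simp) (fun t => by
    rw [theta4Four_add_one, one_mul]), theta2Four_add_one, theta3Four_add_one,
    weierstrassEta_add_one]
  ring

lemma I_div_pi_mul_pi : I / (Real.pi : ℂ) * (Real.pi * I) = -1 := by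
  have hp : (Real.pi : ℂ) ≠ 0 := ofReal_ne_zero.mpr Real.pi_ne_zero
  field_simp
  exact I_sq

/-- The anomaly `2τ` of a logarithmic derivative in weight two cancels the one coming from `η`, so
the defects transform without a remainder. -/
lemma defect2_neg_one_div {τ : ℂ} (h : 0 < τ.im) : defect2 (-1 / τ) = τ ^ 2 * defect4 τ := by
  rw [defect2, defect4, logDeriv_neg_one_div_of_weight_two h (fun t => theta2Four_neg_one_div)
    (differentiableAt_theta2Four (im_neg_one_div_pos h)) (differentiableAt_theta4Four h)
    (theta4Four_ne_zero h), theta3Four_neg_one_div h, theta4Four_neg_one_div h,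
    weierstrassEta_neg_one_div h]
  linear_combination 2 * τ * I_div_pi_mul_pi

lemma defect4_neg_one_div {τ : ℂ} (h : 0 < τ.im) : defect4 (-1 / τ) = τ ^ 2 * defect2 τ := by
  rw [defect2, defect4, logDeriv_neg_one_div_of_weight_two h (fun t => theta4Four_neg_one_div)
    (differentiableAt_theta4Four (im_neg_one_div_pos h)) (differentiableAt_theta2Four h)
    (theta2Four_ne_zero h), theta3Four_neg_one_div h, theta2Four_neg_one_div h,
    weierstrassEta_neg_one_div h]
  linear_combination 2 * τ * I_div_pi_mul_pi

lemma defect3_neg_one_div {τ : ℂ} (h : 0 < τ.im) : defect3 (-1 / τ) = τ ^ 2 * defect3 τ := by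
  rw [defect3, defect3, logDeriv_neg_one_div_of_weight_two h (fun t => theta3Four_neg_one_div)
    (differentiableAt_theta3Four (im_neg_one_div_pos h)) (differentiableAt_theta3Four h)
    (theta3Four_ne_zero h), theta4Four_neg_one_div h, theta2Four_neg_one_div h,
    weierstrassEta_neg_one_div h]
  linear_combination 2 * τ * I_div_pi_mul_pi

lemma differentiableAt_defect2 {τ : ℂ} (h : 0 < τ.im) : DifferentiableAt ℂ defect2 τ :=
  (differentiableAt_logDeriv (fun _ => differentiableAt_theta2Four) h (theta2Four_ne_zero h)).sub
    (((differentiableAt_weierstrassEta h).add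
    (((differentiableAt_theta3Four h).add (differentiableAt_theta4Four h)).const_mul _)).const_mul _)

lemma differentiableAt_defect3 {τ : ℂ} (h : 0 < τ.im) : DifferentiableAt ℂ defect3 τ :=
  (differentiableAt_logDeriv (fun _ => differentiableAt_theta3Four) h (theta3Four_ne_zero h)).sub
    (((differentiableAt_weierstrassEta h).add
    (((differentiableAt_theta2Four h).sub (differentiableAt_theta4Four h)).const_mul _)).const_mul _)

lemma differentiableAt_defect4 {τ : ℂ} (h : 0 < τ.im) : DifferentiableAt ℂ defect4 τ :=
  (differentiableAt_logDeriv (fun _ => differentiableAt_theta4Four) h (theta4Four_ne_zero h)).sub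
    (((differentiableAt_weierstrassEta h).sub
    (((differentiableAt_theta3Four h).add (differentiableAt_theta2Four h)).const_mul _)).const_mul _)

lemma tendsto_defect2_imInfty : Tendsto defect2 imInfty (𝓝 0) := by
  have := tendsto_logDeriv_theta2Four_imInfty.sub ((tendsto_weierstrassEta_imInfty.add
    ((tendsto_theta3Four_imInfty.add tendsto_theta4Four_imInfty).const_mul
      ((Real.pi : ℂ) ^ 2 / 12))).const_mul (4 * I / Real.pi))
  have hp : (Real.pi : ℂ) ≠ 0 := ofReal_ne_zero.mpr Real.pi_ne_zero
  rw [show Real.pi * I - 4 * I / Real.pi * ((Real.pi : ℂ) ^ 2 / 12 + (Real.pi : ℂ) ^ 2 / 12 *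
    (1 + 1)) = 0 by field_simp; ring] at this
  exact this

lemma tendsto_defect3_imInfty : Tendsto defect3 imInfty (𝓝 0) := by
  have := (tendsto_logDeriv_imInfty one_ne_zero (fun _ => differentiableAt_theta3Four)
    tendsto_theta3Four_imInfty).sub ((tendsto_weierstrassEta_imInfty.add
    ((tendsto_theta2Four_imInfty.sub tendsto_theta4Four_imInfty).const_mul
      ((Real.pi : ℂ) ^ 2 / 12))).const_mul (4 * I / Real.pi))
  rw [show 0 - 4 * I / Real.pi * ((Real.pi : ℂ) ^ 2 / 12 + (Real.pi : ℂ) ^ 2 / 12 *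
    (0 - 1)) = 0 by ring] at this
  exact this

lemma tendsto_defect4_imInfty : Tendsto defect4 imInfty (𝓝 0) := by
  have := (tendsto_logDeriv_imInfty one_ne_zero (fun _ => differentiableAt_theta4Four)
    tendsto_theta4Four_imInfty).sub ((tendsto_weierstrassEta_imInfty.sub
    ((tendsto_theta3Four_imInfty.add tendsto_theta2Four_imInfty).const_mul
      ((Real.pi : ℂ) ^ 2 / 12))).const_mul (4 * I / Real.pi))
  rw [show 0 - 4 * I / Real.pi * ((Real.pi : ℂ) ^ 2 / 12 - (Real.pi : ℂ) ^ 2 / 12 *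
    (1 + 0)) = 0 by ring] at this
  exact this

/-- The generators permute the defects up to the factor `τ²`, so symmetric polynomials in them have
level one although the defects themselves do not. -/
lemma defect_sum_eq_zero {τ : ℂ} (h : 0 < τ.im) : defect2 τ + defect3 τ + defect4 τ = 0 := by
  refine eq_zero_of_weight_lt_twelve (f := fun t => defect2 t + defect3 t + defect4 t) (k := 2)
    (by norm_num) (fun t ht => ?_) (fun t _ => ?_) (fun t ht => ?_) ?_ h
  · exact ((differentiableAt_defect2 ht).add (differentiableAt_defect3 ht)).add
      (differentiableAt_defect4 ht)
  · simp only [defect2_add_one, defect3_add_one, defect4_add_one]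
    ring
  · simp only [defect2_neg_one_div ht, defect3_neg_one_div ht, defect4_neg_one_div ht]
    norm_cast
    ring
  · simpa using (tendsto_defect2_imInfty.add tendsto_defect3_imInfty).add tendsto_defect4_imInfty

lemma defect_sum_mul_eq_zero {τ : ℂ} (h : 0 < τ.im) :
    defect2 τ * defect3 τ + defect3 τ * defect4 τ + defect4 τ * defect2 τ = 0 := by
  refine eq_zero_of_weight_lt_twelve (f := fun t => defect2 t * defect3 t + defect3 t * defect4 t
    + defect4 t * defect2 t) (k := 4) (by norm_num) (fun t ht => ?_) (fun t _ => ?_)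
    (fun t ht => ?_) ?_ h
  · have h2 := differentiableAt_defect2 ht
    have h3 := differentiableAt_defect3 ht
    have h4 := differentiableAt_defect4 ht
    exact ((h2.mul h3).add (h3.mul h4)).add (h4.mul h2)
  · simp only [defect2_add_one, defect3_add_one, defect4_add_one]
    ring
  · simp only [defect2_neg_one_div ht, defect3_neg_one_div ht, defect4_neg_one_div ht]
    norm_cast
    ring
  · simpa using ((tendsto_defect2_imInfty.mul tendsto_defect3_imInfty).add
      (tendsto_defect3_imInfty.mul tendsto_defect4_imInfty)).add
      (tendsto_defect4_imInfty.mul tendsto_defect2_imInfty)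

lemma defect_mul_eq_zero {τ : ℂ} (h : 0 < τ.im) : defect2 τ * defect3 τ * defect4 τ = 0 := by
  refine eq_zero_of_weight_lt_twelve (f := fun t => defect2 t * defect3 t * defect4 t) (k := 6)
    (by norm_num) (fun t ht => ?_) (fun t _ => ?_) (fun t ht => ?_) ?_ h
  · exact ((differentiableAt_defect2 ht).mul (differentiableAt_defect3 ht)).mul
      (differentiableAt_defect4 ht)
  · simp only [defect2_add_one, defect3_add_one, defect4_add_one]
    ring
  · simp only [defect2_neg_one_div ht, defect3_neg_one_div ht, defect4_neg_one_div ht]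
    norm_cast
    ring
  · simpa using (tendsto_defect2_imInfty.mul tendsto_defect3_imInfty).mul tendsto_defect4_imInfty

/-- By Vieta each of the three numbers is a root of `X³`. -/
lemma eq_zero_of_symmetric_eq_zero {a b c : ℂ} (h1 : a + b + c = 0) (h2 : a * b + b * c + c * a = 0)
    (h3 : a * b * c = 0) : a = 0 ∧ b = 0 ∧ c = 0 := by
  have ha : a ^ 3 = 0 := by linear_combination a ^ 2 * h1 - a * h2 + h3
  have hb : b ^ 3 = 0 := by linear_combination b ^ 2 * h1 - b * h2 + h3
  have hc : c ^ 3 = 0 := by linear_combination c ^ 2 * h1 - c * h2 + h3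
  simp_all

lemma defect_eq_zero {τ : ℂ} (h : 0 < τ.im) : defect2 τ = 0 ∧ defect3 τ = 0 ∧ defect4 τ = 0 :=
  eq_zero_of_symmetric_eq_zero (defect_sum_eq_zero h) (defect_sum_mul_eq_zero h)
    (defect_mul_eq_zero h)

lemma hasDerivAt_of_logDeriv_pow_four {f : ℂ → ℂ} {τ L : ℂ} (hf : DifferentiableAt ℂ f τ)
    (h0 : f τ ≠ 0) (h : logDeriv (fun t => f t ^ 4) τ = 4 * L) : HasDerivAt f (L * f τ) τ := by
  have h1 := hf.hasDerivAt
  have h2 := (h1.pow 4).deriv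
  rw [logDeriv_apply] at h
  change deriv (fun t => f t ^ 4) τ = _ at h2
  rw [h2] at h
  refine h1.congr_deriv ?_
  rw [div_eq_iff (pow_ne_zero 4 h0)] at h
  refine mul_left_cancel₀ (mul_ne_zero (by norm_num : (4 : ℂ) ≠ 0) (pow_ne_zero 3 h0)) ?_
  push_cast at h
  linear_combination h

lemma hasDerivAt_theta2 {τ : ℂ} (h : 0 < τ.im) :
    HasDerivAt theta2 (I / Real.pi * (weierstrassEta τ + (Real.pi : ℂ) ^ 2 / 12 *
      (theta3 τ ^ 4 + theta4 τ ^ 4)) * theta2 τ) τ := by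
  refine hasDerivAt_of_logDeriv_pow_four (differentiableAt_theta2 h) (theta2_ne_zero h) ?_
  have := (defect_eq_zero h).1
  simp only [defect2, theta3Four, theta4Four] at this
  change logDeriv theta2Four τ = _
  linear_combination this

lemma hasDerivAt_theta3 {τ : ℂ} (h : 0 < τ.im) :
    HasDerivAt theta3 (I / Real.pi * (weierstrassEta τ + (Real.pi : ℂ) ^ 2 / 12 *
      (theta3 τ ^ 4 - 2 * theta4 τ ^ 4)) * theta3 τ) τ := by
  refine hasDerivAt_of_logDeriv_pow_four (differentiableAt_theta3 h) (theta3_ne_zero h) ?_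
  have := (defect_eq_zero h).2.1
  have hj := theta3Four_eq h
  simp only [defect3, theta3Four, theta4Four] at this hj
  change logDeriv theta3Four τ = _
  linear_combination this - 4 * I / Real.pi * ((Real.pi : ℂ) ^ 2 / 12) * hj

lemma hasDerivAt_theta4 {τ : ℂ} (h : 0 < τ.im) :
    HasDerivAt theta4 (I / Real.pi * (weierstrassEta τ + (Real.pi : ℂ) ^ 2 / 12 *
      (theta4 τ ^ 4 - 2 * theta3 τ ^ 4)) * theta4 τ) τ := by
  refine hasDerivAt_of_logDeriv_pow_four (differentiableAt_theta4 h) (theta4_ne_zero h) ?_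
  have := (defect_eq_zero h).2.2
  have hj := theta3Four_eq h
  simp only [defect4, theta3Four, theta4Four] at this hj
  change logDeriv theta4Four τ = _
  linear_combination this + 4 * I / Real.pi * ((Real.pi : ℂ) ^ 2 / 12) * hj

/-! ### The derivative of `η` -/

/-- The level one form `ϑ₃⁸ - ϑ₃⁴ϑ₄⁴ + ϑ₄⁸` of weight four. -/
noncomputable def thetaFour (τ : ℂ) : ℂ :=
  theta3Four τ ^ 2 - theta3Four τ * theta4Four τ + theta4Four τ ^ 2

lemma differentiableAt_thetaFour {τ : ℂ} (h : 0 < τ.im) : DifferentiableAt ℂ thetaFour τ := by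
  have h3 := differentiableAt_theta3Four h
  have h4 := differentiableAt_theta4Four h
  exact ((h3.pow 2).sub (h3.mul h4)).add (h4.pow 2)

lemma thetaFour_add_one (τ : ℂ) : thetaFour (τ + 1) = thetaFour τ := by
  rw [thetaFour, thetaFour, theta3Four_add_one, theta4Four_add_one]
  ring

/-- By Jacobi's identity the form equals `ϑ₂⁸ + ϑ₂⁴ϑ₄⁴ + ϑ₄⁸`, which is symmetric under the exchange
of `ϑ₂⁴` and `ϑ₄⁴`. -/
lemma thetaFour_neg_one_div {τ : ℂ} (h : 0 < τ.im) : thetaFour (-1 / τ) = τ ^ 4 * thetaFour τ := by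
  rw [thetaFour, thetaFour, theta3Four_neg_one_div h, theta4Four_neg_one_div h]
  linear_combination τ ^ 4 * (theta2Four τ - theta4Four τ) * -theta3Four_eq h

lemma tendsto_thetaFour_imInfty : Tendsto thetaFour imInfty (𝓝 1) := by
  have := ((tendsto_theta3Four_imInfty.pow 2).sub (tendsto_theta3Four_imInfty.mul
    tendsto_theta4Four_imInfty)).add (tendsto_theta4Four_imInfty.pow 2)
  rw [show (1 : ℂ) ^ 2 - 1 * 1 + 1 ^ 2 = 1 by norm_num] at this
  exact this

lemma deriv_weierstrassEta_neg_one_div {τ : ℂ} (h : 0 < τ.im) :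
    deriv weierstrassEta (-1 / τ) = τ ^ 2 * (2 * τ * weierstrassEta τ +
      τ ^ 2 * deriv weierstrassEta τ - Real.pi * I / 2) := by
  have h0 := ne_zero_of_im_pos h
  have h1 : HasDerivAt (fun t : ℂ => weierstrassEta (-1 / t))
      (deriv weierstrassEta (-1 / τ) * (1 / τ ^ 2)) τ :=
    HasDerivAt.comp (h₂ := weierstrassEta) τ
      (differentiableAt_weierstrassEta (im_neg_one_div_pos h)).hasDerivAt (hasDerivAt_neg_one_div h0)
  have h2 : HasDerivAt (fun t : ℂ => t ^ 2 * weierstrassEta t - Real.pi * I / 2 * t)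
      (2 * τ * weierstrassEta τ + τ ^ 2 * deriv weierstrassEta τ - Real.pi * I / 2) τ := by
    have := ((hasDerivAt_pow 2 τ).mul (differentiableAt_weierstrassEta h).hasDerivAt).sub
      ((hasDerivAt_id τ).const_mul (Real.pi * I / 2 : ℂ))
    refine this.congr_deriv ?_
    simp
  have h3 := h1.unique (h2.congr_of_eventuallyEq (mem_of_superset
    (UpperHalfPlane.isOpen_upperHalfPlaneSet.mem_nhds h) fun t ht => weierstrassEta_neg_one_div ht))
  rw [← h3]
  field_simp

/-- The error has weight 4 and level one, since the anomalies of `η'` and `η²` cancel. Its constant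
term vanishes because `(2i/π)(π²/12)² = iπ³/72`. -/
lemma hasDerivAt_weierstrassEta {τ : ℂ} (h : 0 < τ.im) :
    HasDerivAt weierstrassEta (I / Real.pi * (2 * weierstrassEta τ ^ 2) -
      (Real.pi : ℂ) ^ 3 / 72 * I * (theta3 τ ^ 8 - theta3 τ ^ 4 * theta4 τ ^ 4 + theta4 τ ^ 8)) τ := by
  have hp : (Real.pi : ℂ) ≠ 0 := ofReal_ne_zero.mpr Real.pi_ne_zero
  refine (differentiableAt_weierstrassEta h).hasDerivAt.congr_deriv ?_
  have key : deriv weierstrassEta τ - I / Real.pi * 2 * weierstrassEta τ ^ 2 +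
      (Real.pi : ℂ) ^ 3 / 72 * I * thetaFour τ = 0 := by
    refine eq_zero_of_weight_lt_twelve (f := fun t => deriv weierstrassEta t -
      I / Real.pi * 2 * weierstrassEta t ^ 2 + (Real.pi : ℂ) ^ 3 / 72 * I * thetaFour t) (k := 4)
      (by norm_num) (fun t ht => ?_) (fun t _ => ?_) (fun t ht => ?_) ?_ h
    · have hd : DifferentiableOn ℂ weierstrassEta UpperHalfPlane.upperHalfPlaneSet :=
        fun t ht => (differentiableAt_weierstrassEta ht).differentiableWithinAt
      exact (((hd.deriv UpperHalfPlane.isOpen_upperHalfPlaneSet).differentiableAt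
        (UpperHalfPlane.isOpen_upperHalfPlaneSet.mem_nhds ht)).sub
        (((differentiableAt_weierstrassEta ht).pow 2).const_mul _)).add
        ((differentiableAt_thetaFour ht).const_mul _)
    · simp only [weierstrassEta_add_one, thetaFour_add_one]
      rw [← deriv_comp_add_const, funext weierstrassEta_add_one]
    · simp only [weierstrassEta_neg_one_div ht, thetaFour_neg_one_div ht,
        deriv_weierstrassEta_neg_one_div ht]
      norm_cast
      linear_combination (2 * t ^ 3 * weierstrassEta t - Real.pi * I * t ^ 2 / 2) * I_div_pi_mul_pi
    · have := ((tendsto_deriv_imInfty (fun _ => differentiableAt_weierstrassEta)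
        tendsto_weierstrassEta_imInfty).sub ((tendsto_weierstrassEta_imInfty.pow 2).const_mul
        (I / Real.pi * 2))).add (tendsto_thetaFour_imInfty.const_mul ((Real.pi : ℂ) ^ 3 / 72 * I))
      rw [show 0 - I / Real.pi * 2 * ((Real.pi : ℂ) ^ 2 / 12) ^ 2 + (Real.pi : ℂ) ^ 3 / 72 * I * 1
        = 0 by field_simp; ring] at this
      exact this
  simp only [thetaFour, theta3Four, theta4Four] at key
  linear_combination key

/-! ### Uniqueness for differential equations -/

/-- Two local holomorphic solutions of an autonomous equation with the same initial value agree. -/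
lemma eventuallyEq_of_hasDerivAt {E : Type*} [NormedAddCommGroup E] [NormedSpace ℂ E]
    {F : E → E} {f g : ℂ → E} {τ₀ : ℂ} (hF : ContDiffAt ℂ 1 F (f τ₀))
    (hf : ∀ᶠ τ in 𝓝 τ₀, HasDerivAt f (F (f τ)) τ) (hg : ∀ᶠ τ in 𝓝 τ₀, HasDerivAt g (F (g τ)) τ)
    (h0 : f τ₀ = g τ₀) : f =ᶠ[𝓝 τ₀] g := by
  obtain ⟨K, t, ht, hK⟩ := hF.exists_lipschitzOnWith
  have hft := hf.self_of_nhds.continuousAt.eventually ht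
  have hgt := hg.self_of_nhds.continuousAt.eventually (h0 ▸ ht)
  obtain ⟨r, hr, hball⟩ := Metric.eventually_nhds_iff_ball.mp (hf.and (hg.and (hft.and hgt)))
  filter_upwards [Metric.ball_mem_nhds τ₀ hr] with τ hτ
  -- Restriction to the segment from `τ₀` to `τ` reduces the claim to uniqueness in a real variable.
  set γ : ℝ → ℂ := fun s => τ₀ + (s : ℂ) * (τ - τ₀) with hγ
  have hγd : ∀ s : ℝ, HasDerivAt γ (τ - τ₀) s := fun s => by
    have := (((hasDerivAt_id s).ofReal_comp).mul_const (τ - τ₀)).const_add τ₀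
    rw [ofReal_one, one_mul] at this
    exact this
  have hγm : ∀ s ∈ Set.Icc (0 : ℝ) 1, γ s ∈ Metric.ball τ₀ r := by
    intro s hs
    rw [mem_ball_iff_norm] at hτ ⊢
    simp only [hγ, add_sub_cancel_left, norm_mul, norm_real, Real.norm_eq_abs, abs_of_nonneg hs.1]
    exact (mul_le_of_le_one_left (norm_nonneg _) hs.2).trans_lt hτ
  have hfd : ∀ s ∈ Set.Icc (0 : ℝ) 1, HasDerivAt (f ∘ γ) ((τ - τ₀) • F ((f ∘ γ) s)) s :=
    fun s hs => HasDerivAt.scomp s (hball _ (hγm s hs)).1 (hγd s)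
  have hgd : ∀ s ∈ Set.Icc (0 : ℝ) 1, HasDerivAt (g ∘ γ) ((τ - τ₀) • F ((g ∘ γ) s)) s :=
    fun s hs => HasDerivAt.scomp s (hball _ (hγm s hs)).2.1 (hγd s)
  have hsub : ∀ {s : ℝ}, s ∈ Set.Ico (0 : ℝ) 1 → s ∈ Set.Icc (0 : ℝ) 1 :=
    fun h => Set.Ico_subset_Icc_self h
  have key := ODE_solution_unique_of_mem_Icc_right (v := fun _ x => (τ - τ₀) • F x)
    (s := fun _ => t) (K := ‖τ - τ₀‖₊ * K) (f := f ∘ γ) (g := g ∘ γ) (a := 0) (b := 1)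
    (fun s _ => LipschitzOnWith.of_dist_le_mul fun x hx y hy => by
      rw [dist_smul₀, NNReal.coe_mul, coe_nnnorm, mul_assoc]
      exact mul_le_mul_of_nonneg_left (hK.dist_le_mul x hx y hy) (norm_nonneg _))
    (fun s hs => (hfd s hs).continuousAt.continuousWithinAt)
    (fun s hs => (hfd s (hsub hs)).hasDerivWithinAt)
    (fun s hs => (hball _ (hγm s (hsub hs))).2.2.1)
    (fun s hs => (hgd s hs).continuousAt.continuousWithinAt)
    (fun s hs => (hgd s (hsub hs)).hasDerivWithinAt)
    (fun s hs => (hball _ (hγm s (hsub hs))).2.2.2) (by simp [hγ, h0])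
  have := key (Set.right_mem_Icc.mpr zero_le_one)
  simpa [hγ] using this

/-- Solutions of a scalar linear equation on a connected open set are proportional. -/
lemma eqOn_of_hasDerivAt_linear {D : Set ℂ} (hD : IsOpen D) (hc : IsPreconnected D)
    {f k p : ℂ → ℂ} (hf : ∀ τ ∈ D, HasDerivAt f (p τ * f τ) τ)
    (hk : ∀ τ ∈ D, HasDerivAt k (p τ * k τ) τ) (hk0 : ∀ τ ∈ D, k τ ≠ 0) {τ₀ : ℂ} (h₀ : τ₀ ∈ D)
    (heq : f τ₀ = k τ₀) : Set.EqOn f k D := by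
  have hq : ∀ τ ∈ D, HasDerivAt (fun t => f t / k t) 0 τ := fun τ hτ => by
    refine ((hf τ hτ).div (hk τ hτ) (hk0 τ hτ)).congr_deriv ?_
    rw [div_eq_zero_iff]
    left; ring
  intro τ hτ
  have := hD.is_const_of_deriv_eq_zero hc
    (fun t ht => (hq t ht).differentiableAt.differentiableWithinAt)
    (fun t ht => (hq t ht).deriv) hτ h₀
  simp only [heq, div_self (hk0 _ h₀)] at this
  exact (div_eq_one_iff_eq (hk0 τ hτ)).mp this

/-! ### Elimination of the constants -/

/-- The right-hand side of the canonical system for `(ϑ₃⁴, ϑ₄⁴, η)`. -/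
noncomputable def quarticField (p : ℂ × ℂ × ℂ) : ℂ × ℂ × ℂ :=
  (4 * I / Real.pi * (p.2.2 + (Real.pi : ℂ) ^ 2 / 12 * (p.1 - 2 * p.2.1)) * p.1,
    4 * I / Real.pi * (p.2.2 + (Real.pi : ℂ) ^ 2 / 12 * (p.2.1 - 2 * p.1)) * p.2.1,
    I / Real.pi * (2 * p.2.2 ^ 2) - (Real.pi : ℂ) ^ 3 / 72 * I *
      (p.1 ^ 2 - p.1 * p.2.1 + p.2.1 ^ 2))

lemma contDiff_quarticField : ContDiff ℂ 1 quarticField := by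
  unfold quarticField
  fun_prop

/-- The fourth powers and the shifted `η` which reduce the system to the case `A = B = 1`. -/
noncomputable def quarticOf (A B : ℂ) (v₃ v₄ h : ℂ → ℂ) (τ : ℂ) : ℂ × ℂ × ℂ :=
  (A ^ 4 * v₃ τ ^ 4, B ^ 4 * v₄ τ ^ 4, h τ + (Real.pi : ℂ) ^ 2 / 12 *
    (v₃ τ ^ 4 + v₄ τ ^ 4 - A ^ 4 * v₃ τ ^ 4 - B ^ 4 * v₄ τ ^ 4))

lemma ofReal_pi_ne_zero : (Real.pi : ℂ) ≠ 0 := ofReal_ne_zero.mpr Real.pi_ne_zero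

lemma IsSolution.hasDerivAt_quarticOf {A B : ℂ} {D : Set ℂ} {v₂ v₃ v₄ h : ℂ → ℂ}
    (hs : IsSolution A B D v₂ v₃ v₄ h) {τ : ℂ} (hτ : τ ∈ D) :
    HasDerivAt (quarticOf A B v₃ v₄ h) (quarticField (quarticOf A B v₃ v₄ h τ)) τ := by
  have h3 := (hs.deriv_three τ hτ).pow 4
  have h4 := (hs.deriv_four τ hτ).pow 4
  have hh := hs.deriv_eta τ hτ
  have hx := h3.const_mul (A ^ 4)
  have hy := h4.const_mul (B ^ 4)
  refine (hx.prodMk (hy.prodMk (hh.add ((((h3.add h4).sub hx).sub hy).const_mul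
    ((Real.pi : ℂ) ^ 2 / 12))))).congr_deriv ?_
  have hp := ofReal_pi_ne_zero
  simp only [quarticField, quarticOf]
  refine Prod.ext ?_ (Prod.ext ?_ ?_)
  · simp only
    push_cast
    ring
  · simp only
    push_cast
    ring
  · simp only
    push_cast
    field_simp
    ring

/-! ### Möbius covariance and the direct part -/

lemma hasDerivAt_mobius {a b c δ τ : ℂ} (hdet : a * δ - b * c = 1) (h : c * τ + δ ≠ 0) :
    HasDerivAt (mobius a b c δ) (1 / (c * τ + δ) ^ 2) τ := by
  have h1 : HasDerivAt (fun t : ℂ => a * t + b) a τ := by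
    simpa using ((hasDerivAt_id τ).const_mul a).add_const b
  have h2 : HasDerivAt (fun t : ℂ => c * t + δ) c τ := by
    simpa using ((hasDerivAt_id τ).const_mul c).add_const δ
  refine (h1.div h2 h).congr_deriv ?_
  congr 1
  linear_combination hdet

lemma hasDerivAt_denom (c δ τ : ℂ) : HasDerivAt (fun t : ℂ => c * t + δ) c τ := by
  simpa using ((hasDerivAt_id τ).const_mul c).add_const δ

lemma hasDerivAt_sqrt_branch {c δ τ : ℂ} {D : Set ℂ} {s : ℂ → ℂ} (hD : IsOpen D)
    (hτ : τ ∈ D) (hs : ContinuousOn s D) (hsq : ∀ t ∈ D, s t ^ 2 = c * t + δ)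
    (h : c * τ + δ ≠ 0) : HasDerivAt s (c / (2 * s τ)) τ := by
  have hs0 : s τ ≠ 0 := fun h0 => h (by rw [← hsq τ hτ, h0]; ring)
  have hsc := hs.continuousAt (hD.mem_nhds hτ)
  rw [hasDerivAt_iff_tendsto_slope]
  -- From `(s t - s τ)(s t + s τ) = c (t - τ)` the difference quotient is `c / (s t + s τ)`.
  have hlim : Tendsto (fun t => c / (s t + s τ)) (𝓝[≠] τ) (𝓝 (c / (2 * s τ))) := by
    have h2 : s τ + s τ ≠ 0 := by rw [← two_mul]; exact mul_ne_zero two_ne_zero hs0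
    have := (tendsto_const_nhds (x := c)).div (hsc.tendsto.add_const (s τ)) h2
    rw [← two_mul] at this
    exact this.mono_left nhdsWithin_le_nhds
  refine hlim.congr' ?_
  have hne : ∀ᶠ t in 𝓝 τ, s t + s τ ≠ 0 :=
    (hsc.tendsto.add_const (s τ)).eventually_ne (by
      rw [← two_mul]; exact mul_ne_zero two_ne_zero hs0)
  filter_upwards [nhdsWithin_le_nhds hne, nhdsWithin_le_nhds (hD.mem_nhds hτ),
    self_mem_nhdsWithin] with t ht htD htτ
  have htτ' : t - τ ≠ 0 := sub_ne_zero.mpr htτ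
  rw [slope_def_field, div_eq_div_iff ht htτ']
  linear_combination hsq τ hτ - hsq t htD

/-- The quartic data `(ϑ₃⁴, ϑ₄⁴, η)` transported by a Möbius map. -/
noncomputable def quarticMobius (a b c δ τ : ℂ) : ℂ × ℂ × ℂ :=
  (theta3Four (mobius a b c δ τ) / (c * τ + δ) ^ 2, theta4Four (mobius a b c δ τ) / (c * τ + δ) ^ 2,
    weierstrassEta (mobius a b c δ τ) / (c * τ + δ) ^ 2 + Real.pi * I * c / (2 * (c * τ + δ)))

/-- The summand `πic / (2(cτ + δ))` in the third component absorbs the derivatives of the automorphy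
factors. -/
lemma hasDerivAt_quarticMobius {a b c δ τ : ℂ} (hdet : a * δ - b * c = 1) (h : c * τ + δ ≠ 0)
    (him : 0 < (mobius a b c δ τ).im) :
    HasDerivAt (quarticMobius a b c δ) (quarticField (quarticMobius a b c δ τ)) τ := by
  have hM := hasDerivAt_mobius hdet h
  have hj := hasDerivAt_denom c δ τ
  have h3 := (HasDerivAt.comp τ (hasDerivAt_theta3 him) hM).pow 4
  have h4 := (HasDerivAt.comp τ (hasDerivAt_theta4 him) hM).pow 4
  have he := HasDerivAt.comp τ (hasDerivAt_weierstrassEta him) hM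
  have hj2 := hj.pow 2
  have hj20 : (c * τ + δ) ^ 2 ≠ 0 := pow_ne_zero 2 h
  have hk := (hasDerivAt_const τ (Real.pi * I * c)).div (hj.const_mul (2 : ℂ))
    (mul_ne_zero two_ne_zero h)
  refine ((h3.div hj2 hj20).prodMk ((h4.div hj2 hj20).prodMk ((he.div hj2 hj20).add
    hk))).congr_deriv ?_
  have hp := ofReal_pi_ne_zero
  simp only [quarticField, quarticMobius, theta3Four, theta4Four, Pi.pow_apply, Function.comp_apply]
  generalize theta3 (mobius a b c δ τ) = x
  generalize theta4 (mobius a b c δ τ) = y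
  generalize weierstrassEta (mobius a b c δ τ) = e
  generalize c * τ + δ = j at *
  refine Prod.ext ?_ (Prod.ext ?_ ?_)
  · simp only
    field_simp
    push_cast
    linear_combination (-48 * Real.pi * x ^ 4 * j * c) * I_sq
  · simp only
    field_simp
    push_cast
    linear_combination (-48 * Real.pi * y ^ 4 * j * c) * I_sq
  · simp only
    field_simp
    push_cast
    linear_combination (-288 * Real.pi * e * j * c - 72 * I * Real.pi ^ 2 * j ^ 2 * c ^ 2) * I_sq

lemma isSolution_gen {A B a b c d δ : ℂ} (hA : A ≠ 0) (hB : B ≠ 0) {D : Set ℂ} {s : ℂ → ℂ}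
    (hD : IsOpen D) (h : IsAdmissible a b c δ D s) :
    IsSolution A B D (genTheta2 a b c d δ s) (genTheta3 A a b c δ s) (genTheta4 B a b c δ s)
      (genEta A B a b c δ) := by
  have hp := ofReal_pi_ne_zero
  have hs0 : ∀ τ ∈ D, s τ ≠ 0 := fun τ hτ h0 => h.denom_ne_zero τ hτ (by
    rw [← h.sqrt_sq τ hτ, h0]; ring)
  have hs : ∀ τ ∈ D, HasDerivAt s (c / (2 * s τ)) τ := fun τ hτ =>
    hasDerivAt_sqrt_branch hD hτ h.continuousOn_sqrt h.sqrt_sq (h.denom_ne_zero τ hτ)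
  have hM : ∀ τ ∈ D, HasDerivAt (mobius a b c δ) (1 / (c * τ + δ) ^ 2) τ := fun τ hτ =>
    hasDerivAt_mobius h.det_eq_one (h.denom_ne_zero τ hτ)
  refine ⟨fun τ hτ => ?_, fun τ hτ => ?_, fun τ hτ => ?_, fun τ hτ => ?_⟩
  · have h2 := HasDerivAt.comp τ (hasDerivAt_theta2 (h.im_pos τ hτ)) (hM τ hτ)
    refine ((h2.div (hs τ hτ) (hs0 τ hτ)).const_mul d).congr_deriv ?_
    have hσ := hs0 τ hτ
    simp only [genTheta2, genTheta3, genTheta4, genEta, Function.comp_apply, ← h.sqrt_sq τ hτ]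
    generalize s τ = σ at *
    generalize theta2 (mobius a b c δ τ) = z
    generalize theta3 (mobius a b c δ τ) = x
    generalize theta4 (mobius a b c δ τ) = y
    generalize weierstrassEta (mobius a b c δ τ) = e
    linear_combination (norm := (field_simp; ring)) (-(d * z * c / (2 * σ ^ 3))) * I_sq
  · have h2 := HasDerivAt.comp τ (hasDerivAt_theta3 (h.im_pos τ hτ)) (hM τ hτ)
    refine ((h2.div (hs τ hτ) (hs0 τ hτ)).const_mul (1 / A)).congr_deriv ?_
    have hσ := hs0 τ hτ
    simp only [genTheta3, genTheta4, genEta, Function.comp_apply, ← h.sqrt_sq τ hτ]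
    generalize s τ = σ at *
    generalize theta3 (mobius a b c δ τ) = x
    generalize theta4 (mobius a b c δ τ) = y
    generalize weierstrassEta (mobius a b c δ τ) = e
    linear_combination (norm := (field_simp; ring)) (-(1 / A * x * c / (2 * σ ^ 3))) * I_sq
  · have h2 := HasDerivAt.comp τ (hasDerivAt_theta4 (h.im_pos τ hτ)) (hM τ hτ)
    refine ((h2.div (hs τ hτ) (hs0 τ hτ)).const_mul (1 / B)).congr_deriv ?_
    have hσ := hs0 τ hτ
    simp only [genTheta3, genTheta4, genEta, Function.comp_apply, ← h.sqrt_sq τ hτ]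
    generalize s τ = σ at *
    generalize theta3 (mobius a b c δ τ) = x
    generalize theta4 (mobius a b c δ τ) = y
    generalize weierstrassEta (mobius a b c δ τ) = e
    linear_combination (norm := (field_simp; ring)) (-(1 / B * y * c / (2 * σ ^ 3))) * I_sq
  · have h3 := (HasDerivAt.comp τ (hasDerivAt_theta3 (h.im_pos τ hτ)) (hM τ hτ)).pow 4
    have h4 := (HasDerivAt.comp τ (hasDerivAt_theta4 (h.im_pos τ hτ)) (hM τ hτ)).pow 4
    have he := HasDerivAt.comp τ (hasDerivAt_weierstrassEta (h.im_pos τ hτ)) (hM τ hτ)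
    have hj := hasDerivAt_denom c δ τ
    have hj0 := h.denom_ne_zero τ hτ
    have hm := he.add (((h3.const_mul (1 - 1 / A ^ 4)).add (h4.const_mul (1 - 1 / B ^ 4))).const_mul
      ((Real.pi : ℂ) ^ 2 / 12))
    refine ((((hasDerivAt_const τ (1 : ℂ)).div (hj.pow 2) (pow_ne_zero 2 hj0)).mul hm).add
      (((hasDerivAt_const τ (Real.pi * I * c)).div hj hj0).const_mul (1 / 2 : ℂ))).congr_deriv ?_
    have hσ := hs0 τ hτ
    simp only [genTheta3, genTheta4, genEta, Function.comp_apply, Pi.add_apply, Pi.pow_apply,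
      Pi.div_apply, ← h.sqrt_sq τ hτ]
    generalize s τ = σ at *
    generalize theta3 (mobius a b c δ τ) = x
    generalize theta4 (mobius a b c δ τ) = y
    generalize weierstrassEta (mobius a b c δ τ) = e
    push_cast
    linear_combination (norm := (field_simp; ring)) (-(2 * c * (e + (Real.pi : ℂ) ^ 2 / 12 *
      ((1 - 1 / A ^ 4) * x ^ 4 + (1 - 1 / B ^ 4) * y ^ 4)) / σ ^ 6) -
      Real.pi * I * c ^ 2 / (2 * σ ^ 4)) * I_sq

/-! ### Values of the modular invariant and of theta quotients -/

/-- The modular invariant `(ϑ₃⁸ - ϑ₃⁴ϑ₄⁴ + ϑ₄⁸)³ / (ϑ₂ϑ₃ϑ₄)⁸`. -/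
noncomputable def thetaJ (τ : ℂ) : ℂ := thetaFour τ ^ 3 / thetaProd τ

lemma differentiableAt_thetaJ {τ : ℂ} (h : 0 < τ.im) : DifferentiableAt ℂ thetaJ τ :=
  ((differentiableAt_thetaFour h).pow 3).div (differentiableAt_thetaProd h) (thetaProd_ne_zero h)

lemma thetaJ_smul (γ : SL(2, ℤ)) (z : ℍ) : thetaJ (γ • z : ℍ) = thetaJ z := by
  have := apply_smul_of_generators (f := thetaJ) (k := 0) (fun τ _ => by
    rw [thetaJ, thetaJ, thetaFour_add_one, thetaProd_add_one]) (fun τ h => by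
    have h0 := ne_zero_of_im_pos h
    have hp := thetaProd_ne_zero h
    rw [thetaJ, thetaJ, thetaFour_neg_one_div h, thetaProd_neg_one_div h]
    norm_cast
    field_simp) γ z
  simpa using this

/-- At `i∞` the numerator tends to 1 and the denominator to 0. -/
lemma exists_im_bound_thetaJ (B : ℝ) : ∃ M : ℝ, ∀ τ : ℂ, M ≤ τ.im → B < ‖thetaJ τ‖ := by
  have h1 := tendsto_thetaProd_imInfty.norm.const_mul B
  have h2 := (tendsto_thetaFour_imInfty.pow 3).norm
  have h3 := (h1.eventually_lt h2 (by simp)).and eventually_im_pos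
  obtain ⟨M, hM⟩ := eventually_atTop.mp (eventually_comap.mp h3)
  refine ⟨M, fun τ hτ => ?_⟩
  obtain ⟨h4, h5⟩ := hM τ.im hτ τ rfl
  rwa [thetaJ, norm_div, lt_div_iff₀ (norm_pos_iff.mpr (thetaProd_ne_zero h5))]

/-- A box containing the part of the fundamental domain below height `M`. -/
def box (M : ℝ) : Set ℂ := Set.Icc (-1 / 2) (1 / 2) ×ℂ Set.Icc (1 / 2) M

lemma isCompact_box (M : ℝ) : IsCompact (box M) := isCompact_Icc.reProdIm isCompact_Icc

lemma im_pos_of_mem_box {M : ℝ} {τ : ℂ} (h : τ ∈ box M) : 0 < τ.im :=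
  one_half_pos.trans_le h.2.1

/-- A bounded invariant keeps the representative in the fundamental domain at bounded height. That
domain lies above `√3/2`, so the floor `1/2` of the box is safe. -/
lemma exists_smul_mem_box (B : ℝ) :
    ∃ M : ℝ, ∀ z : ℍ, ‖thetaJ z‖ ≤ B → ∃ γ : SL(2, ℤ), ((γ • z : ℍ) : ℂ) ∈ box M := by
  obtain ⟨M, hM⟩ := exists_im_bound_thetaJ B
  refine ⟨M, fun z hz => ?_⟩
  obtain ⟨γ, hγ⟩ := ModularGroup.exists_smul_mem_fd z
  refine ⟨γ, abs_le.mp ?_ |>.imp (fun h => by rw [neg_div]; exact h) id, ?_, ?_⟩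
  · exact hγ.2
  · have h3 := ModularGroup.three_le_four_mul_im_sq_of_mem_fd hγ
    have h4 := (γ • z).im_pos
    change 1 / 2 ≤ (γ • z).im
    nlinarith
  · by_contra hlt
    have := hM _ (not_le.mp hlt).le
    rw [thetaJ_smul] at this
    linarith

/-- The image is open by the open mapping theorem, closed by compactness of the box, and the plane
is connected. -/
lemma thetaJ_surjective (w : ℂ) : ∃ τ : ℂ, 0 < τ.im ∧ thetaJ τ = w := by
  set H := UpperHalfPlane.upperHalfPlaneSet with hH
  have hopen : IsOpen (thetaJ '' H) := by
    have han : AnalyticOnNhd ℂ thetaJ H := DifferentiableOn.analyticOnNhd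
      (fun t ht => (differentiableAt_thetaJ ht).differentiableWithinAt)
      UpperHalfPlane.isOpen_upperHalfPlaneSet
    rcases han.is_constant_or_isOpen (convex_halfSpace_im_gt 0).isPreconnected with ⟨c, hc⟩ | h
    · obtain ⟨M, hM⟩ := exists_im_bound_thetaJ ‖c‖
      have him : (((max M 1 : ℝ) : ℂ) * I).im = max M 1 := by simp
      have h1 := hM (((max M 1 : ℝ) : ℂ) * I) (by rw [him]; exact le_max_left _ _)
      rw [hc _ (show 0 < (((max M 1 : ℝ) : ℂ) * I).im by
        rw [him]; exact lt_max_of_lt_right one_pos)] at h1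
      exact absurd h1 (lt_irrefl _)
    · exact h H subset_rfl UpperHalfPlane.isOpen_upperHalfPlaneSet
  have hclosed : IsClosed (thetaJ '' H) := by
    refine isClosed_of_closure_subset fun w hw => ?_
    obtain ⟨M, hM⟩ := exists_smul_mem_box (‖w‖ + 1)
    have hK : IsCompact (thetaJ '' box M) := (isCompact_box M).image_of_continuousOn fun t ht =>
      (differentiableAt_thetaJ (im_pos_of_mem_box ht)).continuousAt.continuousWithinAt
    -- Values close to `w` are already taken on one compact box.
    have hsub : thetaJ '' H ∩ Metric.ball w 1 ⊆ thetaJ '' box M := by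
      rintro _ ⟨⟨t, ht, rfl⟩, htw⟩
      have hle : ‖thetaJ t‖ ≤ ‖w‖ + 1 := by
        have := norm_sub_norm_le (thetaJ t) w
        rw [mem_ball_iff_norm] at htw
        linarith
      obtain ⟨γ, hγ⟩ := hM ⟨t, ht⟩ hle
      exact ⟨_, hγ, thetaJ_smul γ ⟨t, ht⟩⟩
    have hw2 : w ∈ closure (thetaJ '' H ∩ Metric.ball w 1) :=
      Metric.isOpen_ball.closure_inter ⟨hw, Metric.mem_ball_self one_pos⟩
    have := closure_minimal hsub hK.isClosed hw2
    exact Set.image_mono (fun t ht => im_pos_of_mem_box ht) this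
  have := IsClopen.eq_univ ⟨hclosed, hopen⟩ ⟨_, ⟨I, by simp [hH], rfl⟩⟩
  have hw : w ∈ thetaJ '' H := this ▸ Set.mem_univ w
  exact hw

/-- As an equation of degree six in `w` it has as roots the six images of `l` under the group
generated by `l ↦ 1/l` and `l ↦ 1 - l`; the difference of the sides splits accordingly. -/
lemma mem_anharmonic_orbit {w l : ℂ}
    (h : (w ^ 2 - w + 1) ^ 3 * (l ^ 2 * (1 - l) ^ 2) = (l ^ 2 - l + 1) ^ 3 * (w ^ 2 * (1 - w) ^ 2)) :
    w = l ∨ w * l = 1 ∨ w + l = 1 ∨ w * (1 - l) = 1 ∨ w * l = l - 1 ∨ w * (l - 1) = l := by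
  have key : (w - l) * (w * l - 1) * (w + l - 1) * (w * (1 - l) - 1) * (w * l - (l - 1)) *
      (w * (l - 1) - l) = 0 := by
    linear_combination -h
  simp only [mul_eq_zero, sub_eq_zero] at key
  tauto

/-- `w` is a value of `ϑ₄⁴ / ϑ₃⁴`. -/
def IsLambdaValue (w : ℂ) : Prop := ∃ τ : ℂ, 0 < τ.im ∧ theta4Four τ = w * theta3Four τ

lemma IsLambdaValue.inv {w : ℂ} (h : IsLambdaValue w) : IsLambdaValue w⁻¹ := by
  obtain ⟨τ, hτ, h⟩ := h
  have h4 := theta4Four_ne_zero hτ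
  have hw : w ≠ 0 := by rintro rfl; simp [h4] at h
  refine ⟨τ + 1, by simpa using hτ, ?_⟩
  rw [theta4Four_add_one, theta3Four_add_one, h, inv_mul_cancel_left₀ hw]

lemma IsLambdaValue.one_sub {w : ℂ} (h : IsLambdaValue w) : IsLambdaValue (1 - w) := by
  obtain ⟨τ, hτ, h⟩ := h
  refine ⟨-1 / τ, im_neg_one_div_pos hτ, ?_⟩
  rw [theta4Four_neg_one_div hτ, theta3Four_neg_one_div hτ]
  linear_combination τ ^ 2 * theta3Four_eq hτ + τ ^ 2 * h

/-- Surjectivity of the invariant provides some value `l` in the anharmonic orbit of `w`; the set of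
values is closed under that orbit's generators. -/
lemma isLambdaValue_of_ne {w : ℂ} (h0 : w ≠ 0) (h1 : w ≠ 1) : IsLambdaValue w := by
  obtain ⟨τ, hτ, hJ⟩ := thetaJ_surjective ((w ^ 2 - w + 1) ^ 3 / (w ^ 2 * (1 - w) ^ 2))
  have hx := theta3Four_ne_zero hτ
  have hy := theta4Four_ne_zero hτ
  have hz := theta2Four_ne_zero hτ
  have hP := thetaProd_ne_zero hτ
  have hz' : theta2Four τ = theta3Four τ - theta4Four τ := by rw [theta3Four_eq hτ]; ring
  set l := theta4Four τ / theta3Four τ with hl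
  have hyl : theta4Four τ = l * theta3Four τ := by rw [hl, div_mul_cancel₀ _ hx]
  have hlam : IsLambdaValue l := ⟨τ, hτ, hyl⟩
  have hl0 : l ≠ 0 := div_ne_zero hy hx
  have hl1 : 1 - l ≠ 0 := by
    intro h
    apply hz
    rw [hz', hyl]
    linear_combination theta3Four τ * h
  have hw1 : 1 - w ≠ 0 := sub_ne_zero.mpr h1.symm
  rw [thetaJ, div_eq_div_iff hP (mul_ne_zero (pow_ne_zero 2 h0) (pow_ne_zero 2 hw1)), thetaFour,
    thetaProd, hz', hyl] at hJ
  have horb := mem_anharmonic_orbit (w := w) (l := l) (by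
    refine mul_left_cancel₀ (pow_ne_zero 6 hx) ?_
    linear_combination -hJ)
  rcases horb with h | h | h | h | h | h
  · rwa [h]
  · rw [eq_inv_of_mul_eq_one_left h]
    exact hlam.inv
  · rw [eq_sub_of_add_eq h]
    exact hlam.one_sub
  · rw [eq_inv_of_mul_eq_one_left h]
    exact hlam.one_sub.inv
  · rw [show w = 1 - l⁻¹ by field_simp; exact h]
    exact hlam.inv.one_sub
  · rw [show w = 1 - (1 - l)⁻¹ by field_simp; linear_combination -h]
    exact hlam.one_sub.inv.one_sub

lemma theta2_add_two (τ : ℂ) : theta2 (τ + 2) = I * theta2 τ := by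
  have e : cexp (Real.pi * I / 4) * cexp (Real.pi * I / 4) = I := by
    rw [← Complex.exp_add, show (Real.pi * I / 4 + Real.pi * I / 4 : ℂ) = Real.pi / 2 * I by ring,
      exp_pi_div_two_mul_I]
  rw [show τ + 2 = τ + 1 + 1 by ring, theta2_add_one, theta2_add_one, ← mul_assoc, e]

lemma theta3_add_two (τ : ℂ) : theta3 (τ + 2) = theta3 τ := by
  rw [show τ + 2 = τ + 1 + 1 by ring, theta3_add_one, theta4_add_one]

/-- `w` is a value of `ϑ₄ / ϑ₃`. -/
def IsThetaQuotient (w : ℂ) : Prop := ∃ τ : ℂ, 0 < τ.im ∧ theta4 τ = w * theta3 τ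

/-- Inversion turns `ϑ₄/ϑ₃` into `ϑ₂/ϑ₃`, on which a shift by 2 acts as multiplication by `i`; a
second inversion goes back. This reaches all fourth roots, so that `ϑ₃` and `ϑ₄` can later share one
square root. -/
lemma IsThetaQuotient.I_mul {w : ℂ} (h : IsThetaQuotient w) : IsThetaQuotient (I * w) := by
  obtain ⟨τ, hτ, h⟩ := h
  have hσ := im_neg_one_div_pos hτ
  have hσ2 : 0 < (-1 / τ + 2).im := by simpa using hσ
  refine ⟨-1 / (-1 / τ + 2), im_neg_one_div_pos hσ2, ?_⟩
  rw [theta4_neg_one_div hσ2, theta3_neg_one_div hσ2, theta2_add_two, theta3_add_two,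
    theta2_neg_one_div hτ, theta3_neg_one_div hτ, h]
  ring

lemma isThetaQuotient_of_ne {w : ℂ} (h0 : w ≠ 0) (h1 : w ^ 4 ≠ 1) : IsThetaQuotient w := by
  obtain ⟨τ, hτ, h⟩ := isLambdaValue_of_ne (pow_ne_zero 4 h0) h1
  have h3 := theta3_ne_zero hτ
  set u := theta4 τ / theta3 τ with hu
  have hyu : theta4 τ = u * theta3 τ := by rw [hu, div_mul_cancel₀ _ h3]
  have hq : IsThetaQuotient u := ⟨τ, hτ, hyu⟩
  rw [theta4Four, theta3Four, hyu, mul_pow] at h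
  have h4 := mul_right_cancel₀ (pow_ne_zero 4 h3) h
  have key : (w - u) * (w - I * u) * (w - I * (I * u)) * (w - I * (I * (I * u))) = 0 := by
    linear_combination (norm := (ring_nf; simp [I_sq, I_pow_three, I_pow_four]; try ring)) -h4
  simp only [mul_eq_zero, sub_eq_zero] at key
  rcases key with ((h | h) | h) | h <;> rw [h]
  · exact hq
  · exact hq.I_mul
  · exact hq.I_mul.I_mul
  · exact hq.I_mul.I_mul.I_mul

/-! ### Continuation along the domain -/

/-- The polynomial whose square is `(ϑ₂ϑ₃ϑ₄)⁸`. -/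
def quarticDisc (p : ℂ × ℂ × ℂ) : ℂ := p.1 * p.2.1 * (p.1 - p.2.1)

lemma continuous_quarticDisc : Continuous quarticDisc := by
  unfold quarticDisc
  fun_prop

lemma hasDerivAt_quarticDisc {Q : ℂ → ℂ × ℂ × ℂ} {τ : ℂ}
    (h : HasDerivAt Q (quarticField (Q τ)) τ) :
    HasDerivAt (fun t => quarticDisc (Q t)) (12 * I / Real.pi * (Q τ).2.2 * quarticDisc (Q τ)) τ := by
  have h1 : HasDerivAt (fun t => (Q t).1) (quarticField (Q τ)).1 τ :=
    (ContinuousLinearMap.fst ℂ ℂ (ℂ × ℂ)).hasFDerivAt.comp_hasDerivAt τ h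
  have h0 : HasDerivAt (fun t => (Q t).2) (quarticField (Q τ)).2 τ :=
    (ContinuousLinearMap.snd ℂ ℂ (ℂ × ℂ)).hasFDerivAt.comp_hasDerivAt τ h
  have h2 : HasDerivAt (fun t => (Q t).2.1) (quarticField (Q τ)).2.1 τ :=
    (ContinuousLinearMap.fst ℂ ℂ ℂ).hasFDerivAt.comp_hasDerivAt τ h0
  refine ((h1.mul h2).mul (h1.sub h2)).congr_deriv ?_
  simp only [quarticField, quarticDisc, Pi.mul_apply, Pi.sub_apply]
  ring

/-- The discriminant obeys a linear equation along a solution, so its zero set is open as well as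
closed in `D`. -/
lemma quarticDisc_ne_zero {D : Set ℂ} (hD : IsOpen D) (hc : IsPreconnected D)
    {Q : ℂ → ℂ × ℂ × ℂ} (hQ : ∀ τ ∈ D, HasDerivAt Q (quarticField (Q τ)) τ) {τ₀ : ℂ} (h₀ : τ₀ ∈ D)
    (hne : quarticDisc (Q τ₀) ≠ 0) {τ : ℂ} (hτ : τ ∈ D) : quarticDisc (Q τ) ≠ 0 := by
  intro hzero
  set u : Set ℂ := {t | t ∈ D ∧ quarticDisc (Q t) = 0} with hu
  have hopen : IsOpen u := by
    rw [isOpen_iff_mem_nhds]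
    rintro t ⟨htD, ht⟩
    set F : (ℂ × ℂ × ℂ) × ℂ → (ℂ × ℂ × ℂ) × ℂ :=
      fun p => (quarticField p.1, 12 * I / Real.pi * p.1.2.2 * p.2) with hF
    have hFc : ContDiff ℂ 1 F := by
      have := contDiff_quarticField
      fun_prop
    -- Both `(Q, quarticDisc Q)` and `(Q, 0)` solve the augmented system and agree at `t`.
    have hev := eventuallyEq_of_hasDerivAt (F := F) (f := fun z => (Q z, quarticDisc (Q z)))
      (g := fun z => (Q z, 0)) hFc.contDiffAt
      (by
        filter_upwards [hD.mem_nhds htD] with z hz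
        exact (hQ z hz).prodMk (hasDerivAt_quarticDisc (hQ z hz)))
      (by
        filter_upwards [hD.mem_nhds htD] with z hz
        refine ((hQ z hz).prodMk (hasDerivAt_const z (0 : ℂ))).congr_deriv ?_
        simp [hF])
      (by simp [ht])
    filter_upwards [hev, hD.mem_nhds htD] with z hz hzD
    exact ⟨hzD, congrArg Prod.snd hz⟩
  have hsub : D ⊆ u := by
    refine hc.subset_of_closure_inter_subset hopen ⟨τ, hτ, hτ, hzero⟩ ?_
    rintro t ⟨htc, htD⟩
    refine ⟨htD, ?_⟩
    have hcont : ContinuousAt (fun z => quarticDisc (Q z)) t :=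
      (hasDerivAt_quarticDisc (hQ t htD)).continuousAt
    have := mem_closure_iff_frequently.mp htc
    by_contra hne'
    obtain ⟨z, hz1, hz2⟩ := (this.and_eventually (hcont.eventually_ne hne')).exists
    exact hz2 hz1.2
  exact hne (hsub h₀).2

lemma coe_smul_eq (γ : SL(2, ℤ)) (z : ℍ) : ((γ • z : ℍ) : ℂ) =
    ((γ 0 0 : ℂ) * z + γ 0 1) / ((γ 1 0 : ℂ) * z + γ 1 1) := by
  rw [UpperHalfPlane.coe_specialLinearGroup_apply]
  simp

/-- The inverse of the denominator is the denominator of `γ⁻¹` at `w = γ • z`. It is a nonzero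
integer, or its imaginary part has modulus at least `Im w ≥ 1/2`. -/
lemma norm_denom_le_two {γ : SL(2, ℤ)} {z : ℍ} (h : 1 / 2 ≤ ((γ • z : ℍ) : ℂ).im) :
    ‖(γ 1 0 : ℂ) * z + γ 1 1‖ ≤ 2 := by
  set u := (γ 1 0 : ℂ) * z + γ 1 1 with hu
  have hu0 : u ≠ 0 := by
    have := UpperHalfPlane.denom_ne_zero γ z
    rwa [ModularGroup.denom_apply] at this
  have hdet : (γ 0 0 : ℂ) * γ 1 1 - γ 0 1 * γ 1 0 = 1 := by
    have := γ.det_coe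
    rw [Matrix.det_fin_two] at this
    exact_mod_cast this
  set w : ℂ := ((γ • z : ℍ) : ℂ) with hw
  have hinv : -(γ 1 0 : ℂ) * w + γ 0 0 = u⁻¹ := by
    rw [hw, coe_smul_eq]
    change _ * (_ / u) + _ = _
    field_simp
    rw [hu]
    linear_combination hdet
  have hlow : 1 / 2 ≤ ‖u⁻¹‖ := by
    rw [← hinv]
    rcases eq_or_ne (γ 1 0) 0 with h0 | h0
    · rw [h0]
      have h00 : γ 0 0 ≠ 0 := by
        intro h00
        rw [h0, h00] at hdet
        simp at hdet
      have : (1 : ℝ) ≤ |(γ 0 0 : ℝ)| := by exact_mod_cast Int.one_le_abs h00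
      simp only [Int.cast_zero, neg_zero, zero_mul, zero_add, norm_intCast]
      linarith
    · have h1 : (1 : ℝ) ≤ |(γ 1 0 : ℝ)| := by exact_mod_cast Int.one_le_abs h0
      have h2 : (-(γ 1 0 : ℂ) * w + γ 0 0).im = -((γ 1 0 : ℝ) * w.im) := by simp
      have h3 := abs_im_le_norm (-(γ 1 0 : ℂ) * w + γ 0 0)
      rw [h2, abs_neg, abs_mul] at h3
      have h4 : w.im ≤ |w.im| := le_abs_self _
      nlinarith
  rw [norm_inv] at hlow
  have hpos : 0 < ‖u‖ := norm_pos_iff.mpr hu0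
  rw [← one_div, div_le_div_iff₀ two_pos hpos] at hlow
  linarith

lemma thetaProd_eq_quarticDisc {τ : ℂ} (h : 0 < τ.im) (e : ℂ) :
    thetaProd τ = quarticDisc (theta3Four τ, theta4Four τ, e) ^ 2 := by
  rw [thetaProd, quarticDisc, theta3Four_eq h]
  ring

/-- With `v` the denominator of `γ` at `T`, weight 12 gives `k ≤ |v j|¹² P`, that is `r ≤ |v| |j|`.
Then `|v| ≤ 2` bounds `|j|` from below, while `|j| ≤ R` bounds `|v|` and hence `Im T = |v|² Im (γ •
T)`. -/
lemma lower_bounds_of_smul_mem_box {T : ℍ} {γ : SL(2, ℤ)} {M k P r R : ℝ} {j q : ℂ}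
    (hprod : thetaProd T = j ^ 12 * q) (hγ : ((γ • T : ℍ) : ℂ) ∈ box M)
    (hk : ∀ z ∈ box M, k ≤ ‖thetaProd z‖) (hq : ‖q‖ ≤ P) (hP0 : 0 < P) (hr : r ^ 12 = k / P)
    (hr0 : 0 < r) (hj : j ≠ 0) (hjR : ‖j‖ ≤ R) (hR0 : 0 < R) :
    r / 2 ≤ ‖j‖ ∧ 1 / 2 * (r / R) ^ 2 ≤ T.im := by
  have hu2 := norm_denom_le_two hγ.2.1
  have hsm := apply_smul_of_generators (fun s _ => thetaProd_add_one s)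
    (fun s => thetaProd_neg_one_div) γ T
  have him := ModularGroup.im_smul_eq_div_normSq γ T
  rw [ModularGroup.denom_apply] at hsm him
  have hge := hk _ hγ
  rw [hsm, hprod] at hge
  generalize (γ 1 0 : ℂ) * T + γ 1 1 = v at *
  have hrj : r ≤ ‖v‖ * ‖j‖ := by
    refine le_of_pow_le_pow_left₀ (n := 12) (by norm_num) (by positivity) ?_
    rw [hr, div_le_iff₀ hP0]
    refine hge.trans ?_
    rw [norm_mul, norm_zpow, norm_mul, norm_pow, ← mul_assoc, mul_pow]
    exact mul_le_mul_of_nonneg_left hq (by positivity)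
  have hjpos : 0 < ‖j‖ := norm_pos_iff.mpr hj
  have hvn : 0 ≤ ‖v‖ := norm_nonneg v
  constructor
  · nlinarith
  · have hv1 : r / R ≤ ‖v‖ := by
      rw [div_le_iff₀ hR0]
      nlinarith
    have hvpos : 0 < ‖v‖ := (div_pos hr0 hR0).trans_le hv1
    have h12 : 1 / 2 ≤ (γ • T).im := hγ.2.1
    rw [him, Complex.normSq_eq_norm_sq, le_div_iff₀ (pow_pos hvpos 2)] at h12
    have h3 : (r / R) ^ 2 ≤ ‖v‖ ^ 2 := pow_le_pow_left₀ (div_pos hr0 hR0).le hv1 2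
    linarith

/-- A local identity with a Möbius transported theta solution propagates along `D`. -/
lemma eq_quarticMobius_of_isPreconnected {D : Set ℂ} (hD : IsOpen D) (hc : IsPreconnected D)
    {Q : ℂ → ℂ × ℂ × ℂ} (hQ : ∀ τ ∈ D, HasDerivAt Q (quarticField (Q τ)) τ) {a b c δ τ₀ : ℂ}
    (hdet : a * δ - b * c = 1) (h₀ : τ₀ ∈ D) (hj₀ : c * τ₀ + δ ≠ 0)
    (him₀ : 0 < (mobius a b c δ τ₀).im) (heq₀ : Q τ₀ = quarticMobius a b c δ τ₀)
    (hne : quarticDisc (Q τ₀) ≠ 0) {τ : ℂ} (hτ : τ ∈ D) :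
    c * τ + δ ≠ 0 ∧ 0 < (mobius a b c δ τ).im ∧ Q τ = quarticMobius a b c δ τ := by
  set u : Set ℂ := {t | t ∈ D ∧ c * t + δ ≠ 0 ∧ 0 < (mobius a b c δ t).im ∧
    Q t = quarticMobius a b c δ t} with hu
  have hjc : Continuous fun t : ℂ => c * t + δ := by fun_prop
  have hopen : IsOpen u := by
    rw [isOpen_iff_mem_nhds]
    rintro t ⟨htD, htj, htim, hteq⟩
    have hev : ∀ᶠ z in 𝓝 t, z ∈ D ∧ c * z + δ ≠ 0 ∧ 0 < (mobius a b c δ z).im := by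
      refine (hD.eventually_mem htD).and
        ((hjc.continuousAt.eventually_ne htj).and ?_)
      exact (continuous_im.continuousAt.comp (hasDerivAt_mobius hdet htj).continuousAt).eventually
        (lt_mem_nhds htim)
    have hsol := eventuallyEq_of_hasDerivAt (F := quarticField) (f := Q)
      (g := quarticMobius a b c δ) contDiff_quarticField.contDiffAt
      (hev.mono fun z hz => hQ z hz.1)
      (hev.mono fun z hz => hasDerivAt_quarticMobius hdet hz.2.1 hz.2.2) hteq
    filter_upwards [hev, hsol] with z hz hz2
    exact ⟨hz.1, hz.2.1, hz.2.2, hz2⟩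
  have hsub : D ⊆ u := by
    refine hc.subset_of_closure_inter_subset hopen ⟨τ₀, h₀, h₀, hj₀, him₀, heq₀⟩ ?_
    rintro t ⟨htc, htD⟩
    have hfreq := mem_closure_iff_frequently.mp htc
    have hQc := (hQ t htD).continuousAt
    have hdisc := quarticDisc_ne_zero hD hc hQ h₀ hne htD
    have hPc : ContinuousAt (fun z => quarticDisc (Q z) ^ 2) t :=
      (continuous_quarticDisc.continuousAt.comp hQc).pow 2
    -- This expression is the modular invariant written in terms of `Q`; it stays bounded near `t`
    -- because the discriminant does not vanish there.
    have hJc : ContinuousAt (fun z => ((Q z).1 ^ 2 - (Q z).1 * (Q z).2.1 + (Q z).2.1 ^ 2) ^ 3 /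
        quarticDisc (Q z) ^ 2) t := by
      refine ContinuousAt.div ?_ hPc (pow_ne_zero 2 hdisc)
      fun_prop
    obtain ⟨B, hB⟩ : ∃ B, ∀ᶠ z in 𝓝 t, ‖((Q z).1 ^ 2 - (Q z).1 * (Q z).2.1 + (Q z).2.1 ^ 2) ^ 3 /
        quarticDisc (Q z) ^ 2‖ < B := ⟨_, hJc.norm.eventually (gt_mem_nhds (lt_add_one _))⟩
    obtain ⟨P, hP⟩ : ∃ P, ∀ᶠ z in 𝓝 t, ‖quarticDisc (Q z) ^ 2‖ < P :=
      ⟨_, hPc.norm.eventually (gt_mem_nhds (lt_add_one _))⟩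
    obtain ⟨R, hR⟩ : ∃ R, ∀ᶠ z in 𝓝 t, ‖c * z + δ‖ < R :=
      ⟨_, hjc.continuousAt.norm.eventually (gt_mem_nhds (lt_add_one _))⟩
    obtain ⟨M, hM⟩ := exists_smul_mem_box B
    obtain ⟨k, hk, hkbox⟩ : ∃ k > 0, ∀ z ∈ box M, k ≤ ‖thetaProd z‖ := by
      rcases (box M).eq_empty_or_nonempty with he | hne'
      · exact ⟨1, one_pos, by simp [he]⟩
      · obtain ⟨z, hz, hmin⟩ := (isCompact_box M).exists_isMinOn hne'
          (f := fun z => ‖thetaProd z‖) fun z hz =>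
            (differentiableAt_thetaProd (im_pos_of_mem_box hz)).continuousAt.norm.continuousWithinAt
        exact ⟨_, norm_pos_iff.mpr (thetaProd_ne_zero (im_pos_of_mem_box hz)), fun y hy => hmin hy⟩
    have hP0 : 0 < P := (norm_nonneg _).trans_lt hP.self_of_nhds
    have hR0 : 0 < R := (norm_nonneg _).trans_lt hR.self_of_nhds
    obtain ⟨r, hr0, hr⟩ : ∃ r : ℝ, 0 < r ∧ r ^ 12 = k / P :=
      ⟨(k / P) ^ ((12 : ℕ) : ℝ)⁻¹, by positivity, Real.rpow_inv_natCast_pow (by positivity) (by norm_num)⟩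
    -- The constants do not depend on `z`, so both lower bounds persist in the limit `z → t`.
    have hbounds : ∃ᶠ z in 𝓝 t, z ∈ u ∧ r / 2 ≤ ‖c * z + δ‖ ∧
        1 / 2 * (r / R) ^ 2 ≤ (mobius a b c δ z).im := by
      refine (hfreq.and_eventually (hB.and (hP.and hR))).mono ?_
      rintro z ⟨hzu, hzB, hzP, hzR⟩
      refine ⟨hzu, ?_⟩
      obtain ⟨-, hzj, hzim, hzeq⟩ := hzu
      set j := c * z + δ with hj
      set T : ℍ := ⟨mobius a b c δ z, hzim⟩ with hT
      have hprod : thetaProd T = j ^ 12 * quarticDisc (Q z) ^ 2 := by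
        rw [thetaProd_eq_quarticDisc hzim 0, hzeq]
        simp only [quarticDisc, quarticMobius, ← hj]
        field_simp
      have hfour : thetaFour T = j ^ 4 * ((Q z).1 ^ 2 - (Q z).1 * (Q z).2.1 + (Q z).2.1 ^ 2) := by
        rw [hzeq]
        simp only [thetaFour, quarticMobius, hT, ← hj]
        field_simp
      have hJ : ‖thetaJ T‖ ≤ B := by
        rw [thetaJ, hprod, hfour, mul_pow, ← pow_mul, mul_div_mul_left _ _ (pow_ne_zero _ hzj)]
        exact hzB.le
      obtain ⟨γ, hγ⟩ := hM T hJ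
      exact lower_bounds_of_smul_mem_box hprod hγ hkbox hzP.le hP0 hr hr0 hzj hzR.le hR0
    have htj : c * t + δ ≠ 0 := by
      intro h0
      have hlt : ∀ᶠ z in 𝓝 t, ‖c * z + δ‖ < r / 2 :=
        hjc.continuousAt.norm.eventually (gt_mem_nhds (by simpa [h0] using hr0))
      obtain ⟨z, hz, hz'⟩ := (hbounds.and_eventually hlt).exists
      linarith [hz.2.1]
    have hMc := (hasDerivAt_mobius hdet htj).continuousAt
    have htim : 0 < (mobius a b c δ t).im := by
      by_contra hle
      have hpos : 0 < 1 / 2 * (r / R) ^ 2 := by positivity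
      have hlt : ∀ᶠ z in 𝓝 t, (mobius a b c δ z).im < 1 / 2 * (r / R) ^ 2 :=
        (continuous_im.continuousAt.comp hMc).eventually
          (gt_mem_nhds ((not_lt.mp hle).trans_lt hpos))
      obtain ⟨z, hz, hz'⟩ := (hbounds.and_eventually hlt).exists
      linarith [hz.2.2]
    refine ⟨htD, htj, htim, ?_⟩
    by_contra hne'
    have hgc := (hasDerivAt_quarticMobius hdet htj htim).continuousAt
    have hev : ∀ᶠ z in 𝓝 t, Q z ≠ quarticMobius a b c δ z := (hQc.ne_iff_eventually_ne hgc).mp hne'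
    obtain ⟨z, hz, hz'⟩ := (hfreq.and_eventually hev).exists
    exact hz' hz.2.2.2
  exact (hsub hτ).2

/-! ### The converse: every non-degenerate solution -/

lemma exists_gen_of_isSolution {A B : ℂ} (hA : A ≠ 0) (hB : B ≠ 0) {D : Set ℂ}
    {v₂ v₃ v₄ h : ℂ → ℂ} (hD : IsOpen D) (hc : IsConnected D) (hs : IsSolution A B D v₂ v₃ v₄ h)
    (hne : ∃ τ ∈ D, v₃ τ ≠ 0 ∧ v₄ τ ≠ 0 ∧ A ^ 4 * v₃ τ ^ 4 ≠ B ^ 4 * v₄ τ ^ 4) :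
    ∃ (a b c d δ : ℂ) (s : ℂ → ℂ), IsAdmissible a b c δ D s ∧
      Set.EqOn v₂ (genTheta2 a b c d δ s) D ∧ Set.EqOn v₃ (genTheta3 A a b c δ s) D ∧
      Set.EqOn v₄ (genTheta4 B a b c δ s) D ∧ Set.EqOn h (genEta A B a b c δ) D := by
  obtain ⟨τ₀, h₀, h3, h4, h34⟩ := hne
  have hpi := ofReal_pi_ne_zero
  set p := A * v₃ τ₀ with hp
  set q := B * v₄ τ₀ with hq
  have hp0 : p ≠ 0 := mul_ne_zero hA h3
  have hq0 : q ≠ 0 := mul_ne_zero hB h4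
  have hpq : p ^ 4 ≠ q ^ 4 := by rwa [hp, hq, mul_pow, mul_pow]
  obtain ⟨T, hT, hTq⟩ := isThetaQuotient_of_ne (w := q / p) (div_ne_zero hq0 hp0) (by
    rw [div_pow]
    intro h
    exact hpq ((div_eq_one_iff_eq (pow_ne_zero 4 hp0)).mp h).symm)
  have hx := theta3_ne_zero hT
  set σ := theta3 T / p with hσ
  have hσ0 : σ ≠ 0 := div_ne_zero hx hp0
  have h3T : theta3 T = p * σ := by rw [hσ]; field_simp
  have h4T : theta4 T = q * σ := by rw [hTq, h3T]; field_simp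
  set Q := quarticOf A B v₃ v₄ h with hQdef
  have hQ : ∀ τ ∈ D, HasDerivAt Q (quarticField (Q τ)) τ := fun τ hτ => hs.hasDerivAt_quarticOf hτ
  -- `J` is to be the value of `cτ + δ` at `τ₀`, with root `σ`. The third component of the initial
  -- value determines `c`; the conditions that `τ₀` go to `T` with determinant one determine `a`,
  -- `b`, `δ`.
  set J := σ ^ 2 with hJ
  have hJ0 : J ≠ 0 := pow_ne_zero 2 hσ0
  set c := ((Q τ₀).2.2 - weierstrassEta T / J ^ 2) * (2 * J) / (Real.pi * I) with hcdef
  set δ := J - c * τ₀ with hδ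
  set a := 1 / J + c * T with ha
  set b := T * J - a * τ₀ with hb
  have hj₀ : c * τ₀ + δ = J := by rw [hδ]; ring
  have hdet : a * δ - b * c = 1 := by
    rw [hb, hδ, ha]
    field_simp
    ring
  have hM₀ : mobius a b c δ τ₀ = T := by
    rw [mobius, hj₀, hb]
    field_simp
    ring
  have heq₀ : Q τ₀ = quarticMobius a b c δ τ₀ := by
    rw [quarticMobius, hM₀, hj₀]
    refine Prod.ext ?_ (Prod.ext ?_ ?_)
    · change A ^ 4 * v₃ τ₀ ^ 4 = _
      rw [theta3Four, h3T, hJ, hp]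
      field_simp
    · change B ^ 4 * v₄ τ₀ ^ 4 = _
      rw [theta4Four, h4T, hJ, hq]
      field_simp
    · change (Q τ₀).2.2 = weierstrassEta T / J ^ 2 + Real.pi * I * c / (2 * J)
      rw [hcdef]
      have := I_ne_zero
      field_simp
      ring
  have hdisc₀ : quarticDisc (Q τ₀) ≠ 0 := by
    change (A ^ 4 * v₃ τ₀ ^ 4) * (B ^ 4 * v₄ τ₀ ^ 4) * (A ^ 4 * v₃ τ₀ ^ 4 - B ^ 4 * v₄ τ₀ ^ 4) ≠ 0
    refine mul_ne_zero (mul_ne_zero ?_ ?_) (sub_ne_zero.mpr h34)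
    · exact mul_ne_zero (pow_ne_zero 4 hA) (pow_ne_zero 4 h3)
    · exact mul_ne_zero (pow_ne_zero 4 hB) (pow_ne_zero 4 h4)
  have hall := fun τ (hτ : τ ∈ D) => eq_quarticMobius_of_isPreconnected hD hc.isPreconnected hQ hdet
    h₀ (by rwa [hj₀]) (by rwa [hM₀]) heq₀ hdisc₀ hτ
  have hX : ∀ τ ∈ D, A ^ 4 * v₃ τ ^ 4 * (c * τ + δ) ^ 2 = theta3 (mobius a b c δ τ) ^ 4 := by
    intro τ hτ
    obtain ⟨hj, -, hEq⟩ := hall τ hτ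
    have : A ^ 4 * v₃ τ ^ 4 = theta3 (mobius a b c δ τ) ^ 4 / (c * τ + δ) ^ 2 :=
      congrArg Prod.fst hEq
    rw [this, div_mul_cancel₀ _ (pow_ne_zero 2 hj)]
  have hY : ∀ τ ∈ D, B ^ 4 * v₄ τ ^ 4 * (c * τ + δ) ^ 2 = theta4 (mobius a b c δ τ) ^ 4 := by
    intro τ hτ
    obtain ⟨hj, -, hEq⟩ := hall τ hτ
    have : B ^ 4 * v₄ τ ^ 4 = theta4 (mobius a b c δ τ) ^ 4 / (c * τ + δ) ^ 2 :=
      congrArg (fun z : ℂ × ℂ × ℂ => z.2.1) hEq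
    rw [this, div_mul_cancel₀ _ (pow_ne_zero 2 hj)]
  have hv3 : ∀ τ ∈ D, v₃ τ ≠ 0 := by
    intro τ hτ h0
    have := hX τ hτ
    rw [h0] at this
    exact theta3_ne_zero (hall τ hτ).2.1 (pow_eq_zero_iff four_ne_zero |>.mp (by rw [← this]; ring))
  -- The branch is forced by the formula for `ϑ₃`.
  set s : ℂ → ℂ := fun τ => theta3 (mobius a b c δ τ) / (A * v₃ τ) with hsdef
  have hscont : ContinuousOn s D := fun τ hτ => by
    obtain ⟨hj, him, -⟩ := hall τ hτ
    refine ContinuousAt.continuousWithinAt (ContinuousAt.div ?_ ?_ (mul_ne_zero hA (hv3 τ hτ)))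
    · exact (differentiableAt_theta3 him).continuousAt.comp (hasDerivAt_mobius hdet hj).continuousAt
    · exact continuousAt_const.mul (hs.deriv_three τ hτ).continuousAt
  have hsq : ∀ τ ∈ D, s τ ^ 2 = c * τ + δ := by
    intro τ hτ
    -- Only `s⁴ = (cτ + δ)²` is known so far; connectedness and the value at `τ₀` fix the sign.
    refine hc.isPreconnected.eq_of_sq_eq (f := fun t => s t ^ 2) (g := fun t => c * t + δ)
      (hscont.pow 2) (by fun_prop) (fun t ht => ?_) (fun {t} ht => (hall t ht).1) h₀ ?_ hτ
    · have hv := hv3 t ht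
      simp only [Pi.pow_apply, hsdef]
      rw [← pow_mul, div_pow, ← hX t ht,
        div_eq_iff (pow_ne_zero _ (mul_ne_zero hA hv))]
      ring
    · simp only [hsdef, hM₀, hj₀]
      rfl
  have hadm : IsAdmissible a b c δ D s :=
    ⟨hdet, fun τ hτ => (hall τ hτ).1, fun τ hτ => (hall τ hτ).2.1, hscont, hsq⟩
  have hs0 : ∀ τ ∈ D, s τ ≠ 0 := fun τ hτ h0 => (hall τ hτ).1 (by rw [← hsq τ hτ, h0]; ring)
  have e3 : Set.EqOn v₃ (genTheta3 A a b c δ s) D := fun τ hτ => by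
    have hv := hv3 τ hτ
    have hth := theta3_ne_zero (hall τ hτ).2.1
    simp only [genTheta3, hsdef]
    field_simp
  have e34 : ∀ τ ∈ D, v₄ τ ^ 4 = genTheta4 B a b c δ s τ ^ 4 := fun τ hτ => by
    have hsτ := hs0 τ hτ
    rw [genTheta4, mul_pow, div_pow, div_pow, ← hY τ hτ, ← hsq τ hτ]
    field_simp
  have eh : Set.EqOn h (genEta A B a b c δ) D := fun τ hτ => by
    obtain ⟨hj, -, hEq⟩ := hall τ hτ
    have hE : h τ + (Real.pi : ℂ) ^ 2 / 12 *
        (v₃ τ ^ 4 + v₄ τ ^ 4 - A ^ 4 * v₃ τ ^ 4 - B ^ 4 * v₄ τ ^ 4) =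
        weierstrassEta (mobius a b c δ τ) / (c * τ + δ) ^ 2 + Real.pi * I * c / (2 * (c * τ + δ)) :=
      congrArg (fun z : ℂ × ℂ × ℂ => z.2.2) hEq
    rw [genEta, ← hX τ hτ, ← hY τ hτ, eq_sub_of_add_eq hE]
    field_simp
    ring
  have hgen := isSolution_gen (d := 1) hA hB hD hadm
  -- Equality of fourth powers makes the coefficients of the two linear equations coincide, and the
  -- values agree at `τ₀`.
  have e4 : Set.EqOn v₄ (genTheta4 B a b c δ s) D := by
    refine eqOn_of_hasDerivAt_linear hD hc.isPreconnected hs.deriv_four (fun τ hτ => ?_)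
      (fun τ hτ => ?_) h₀ ?_
    · have := hgen.deriv_four τ hτ
      rwa [← e3 hτ, ← eh hτ, ← e34 τ hτ] at this
    · exact mul_ne_zero (one_div_ne_zero hB)
        (div_ne_zero (theta4_ne_zero (hall τ hτ).2.1) (hs0 τ hτ))
    · have : s τ₀ = σ := by simp only [hsdef, hM₀]; rfl
      rw [genTheta4, hM₀, this, h4T, hq]
      field_simp
  refine ⟨a, b, c, v₂ τ₀ * s τ₀ / theta2 T, δ, s, hadm, ?_, e3, e4, eh⟩
  have hz := theta2_ne_zero hT
  have hq2 : ∀ τ ∈ D, genTheta2 a b c 1 δ s τ ≠ 0 := fun τ hτ => mul_ne_zero one_ne_zero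
    (div_ne_zero (theta2_ne_zero (hall τ hτ).2.1) (hs0 τ hτ))
  set d := v₂ τ₀ * s τ₀ / theta2 T with hd
  -- The constant `d` may be zero, so the comparison is made with the zero-free solution for `d =
  -- 1`, after adding the multiple `1 - d` of it to `v₂`.
  have hlin := eqOn_of_hasDerivAt_linear hD hc.isPreconnected (f := fun τ => v₂ τ +
      (1 - d) * genTheta2 a b c 1 δ s τ) (k := genTheta2 a b c 1 δ s)
      (p := fun τ => I / Real.pi * (h τ + (Real.pi : ℂ) ^ 2 / 12 * (v₃ τ ^ 4 + v₄ τ ^ 4)))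
      (fun τ hτ => ?_) (fun τ hτ => ?_) hq2 h₀ ?_
  · intro τ hτ
    have := hlin hτ
    simp only [genTheta2, one_mul] at this ⊢
    linear_combination this
  · have h2 := hgen.deriv_two τ hτ
    rw [← e3 hτ, ← eh hτ, ← e4 hτ] at h2
    refine ((hs.deriv_two τ hτ).add (h2.const_mul (1 - d))).congr_deriv ?_
    ring
  · have h2 := hgen.deriv_two τ hτ
    rwa [← e3 hτ, ← eh hτ, ← e4 hτ] at h2
  · have := hs0 τ₀ h₀
    simp only [genTheta2, hM₀, hd]
    field_simp
    ring

end ThetaSystem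

theorem theorem9p9 (A B : ℂ) (hA : A ≠ 0) (hB : B ≠ 0) :
    (∀ (a b c d δ : ℂ) (D : Set ℂ) (s : ℂ → ℂ), IsOpen D →
      ThetaSystem.IsAdmissible a b c δ D s →
      ThetaSystem.IsSolution A B D
        (ThetaSystem.genTheta2 a b c d δ s) (ThetaSystem.genTheta3 A a b c δ s)
        (ThetaSystem.genTheta4 B a b c δ s) (ThetaSystem.genEta A B a b c δ)) ∧
    (∀ (D : Set ℂ) (v₂ v₃ v₄ h : ℂ → ℂ), IsOpen D → IsConnected D →
      ThetaSystem.IsSolution A B D v₂ v₃ v₄ h →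
      (∃ τ ∈ D, v₃ τ ≠ 0 ∧ v₄ τ ≠ 0 ∧ A ^ 4 * v₃ τ ^ 4 ≠ B ^ 4 * v₄ τ ^ 4) →
      ∃ (a b c d δ : ℂ) (s : ℂ → ℂ),
        ThetaSystem.IsAdmissible a b c δ D s ∧
        Set.EqOn v₂ (ThetaSystem.genTheta2 a b c d δ s) D ∧
        Set.EqOn v₃ (ThetaSystem.genTheta3 A a b c δ s) D ∧
        Set.EqOn v₄ (ThetaSystem.genTheta4 B a b c δ s) D ∧
        Set.EqOn h (ThetaSystem.genEta A B a b c δ) D) :=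
  ⟨fun _ _ _ _ _ _ _ hD h => ThetaSystem.isSolution_gen hA hB hD h,
    fun _ _ _ _ _ hD hc hs hne => ThetaSystem.exists_gen_of_isSolution hA hB hD hc hs hne⟩
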